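/- **Theorem (Asymptotics for subordination).** Let $(M,\rho)$ be a metric space, let $n,\alpha,C_1,C_2>0$ be real constants, let $F:[0,\infty)\to(0,\infty)$ be non-increasing, and put $F(0+)=\lim_{r\downarrow0}F(r)$. Let $$p(t,x,y)=\frac{C_1}{t^{n/\alpha}}\,F\!\left(C_2\frac{\rho(x,y)}{t^{1/\alpha}}\right),\qquad t>0,\ x,y\in M.$$ Let $0<\beta<1$ and let $S=(S_t)_{t\ge0}$ be a $\beta$-stable subordinator, i.e. a non-decreasing Lévy process on $[0,\infty)$ with $\mathbb E\,e^{-rS_t}=e^{-tr^\beta}$ for all $r>0$, $t\ge0$. Define the subordinated kernel $$p^S(t,x,y)=\int_0^\infty p(s,x,y)\,d_s\mathbb P(S_t\le s),\qquad t>0,\ x,y\in M.$$ This integral converges for all $t>0$ and $x,y\in M$, and the following asymptotics hold, where $f\sim g$ means that $f(t,x,y)/g(t,x,y)\to1$, uniformly over all $t>0$, $x,y\in M$ for which the indicated quantity is close to its limit. (a) If $\int_1^\infty s^{n+\alpha\beta-1}F(s)\,ds<\infty$, then $\int_0^\infty s^{n+\alpha\beta-1}F(s)\,ds<\infty$ and,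 as $\rho(x,y)\,t^{-1/(\alpha\beta)}\to\infty$, $$p^S(t,x,y)\sim C_1\,\frac{\alpha\beta}{\Gamma(1-\beta)}\,C_2^{-n-\alpha\beta}\int_0^\infty s^{n+\alpha\beta-1}F(s)\,ds\cdot\rho(x,y)^{-n-\alpha\beta}\,t.$$ (b) As $\rho(x,y)\,t^{-1/(\alpha\beta)}\to0$ with $x\neq y$, $$p^S(t,x,y)\sim C_1F(0+)\,\frac{\Gamma\!\left(\frac{n}{\alpha\beta}\right)}{\beta\,\Gamma\!\left(\frac n\alpha\right)}\,t^{-n/(\alpha\beta)}.$$ If $F(0)=F(0+)$, then the same holds with the points $x=y$ included. -/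

import Mathlib

open Real Set Filter Topology MeasureTheory ProbabilityTheory Asymptotics
open scoped NNReal

/-- A real-valued Lévy process: started at `0`, with independent and stationary increments,
stochastically continuous, and with almost surely càdlàg paths. -/
structure IsLevyProcess {Ω : Type*} [MeasurableSpace Ω] (P : Measure Ω) (S : ℝ≥0 → Ω → ℝ) :
    Prop where
  measurable : ∀ t, Measurable (S t)
  start_zero : ∀ᵐ ω ∂P, S 0 ω = 0
  indep_increments : HasIndepIncrements S P
  stationary_increments : ∀ s h : ℝ≥0,
    IdentDistrib (fun ω => S (s + h) ω - S s ω) (fun ω => S h ω - S 0 ω) P P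
  stochastically_continuous : ∀ t : ℝ≥0, TendstoInMeasure P S (𝓝 t) (S t)
  cadlag : ∀ᵐ ω ∂P, ∀ t : ℝ≥0, ContinuousWithinAt (fun s => S s ω) (Ici t) t ∧
    ∃ l : ℝ, Tendsto (fun s => S s ω) (𝓝[<] t) (𝓝 l)

/-- A `β`-stable subordinator: a Lévy process with almost surely non-decreasing paths
(hence with values in `[0, ∞)`) and `E exp (-r S_t) = exp (-t r ^ β)` for `r > 0`, `t ≥ 0`. -/
structure IsStableSubordinator {Ω : Type*} [MeasurableSpace Ω] (P : Measure Ω)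
    (β : ℝ) (S : ℝ≥0 → Ω → ℝ) : Prop extends IsLevyProcess P S where
  nondecreasing : ∀ᵐ ω ∂P, Monotone (fun t => S t ω)
  laplace : ∀ r : ℝ, 0 < r → ∀ t : ℝ≥0,
    ∫ ω, exp (-(r * S t ω)) ∂P = exp (-((t : ℝ) * r ^ β))

/-- The kernel `p` subordinated by `S`:
`p^S (t, x, y) = ∫_0^∞ p (s, x, y) d_s P (S_t ≤ s)`. The Lebesgue-Stieltjes measure of the
distribution function `s ↦ P (S_t ≤ s)` is the law `P.map (S t)` of `S_t`. -/
noncomputable def subordinatedKernel {Ω M : Type*} [MeasurableSpace Ω] (P : Measure Ω)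
    (S : ℝ≥0 → Ω → ℝ) (p : ℝ → M → M → ℝ) (t : ℝ≥0) (x y : M) : ℝ :=
  ∫ s in Ioi (0 : ℝ), p s x y ∂(P.map (S t))

/-- The scaling variable `ρ(x, y) t ^ (-1 / γ)` as a function of `(t, x, y)`. -/
noncomputable def scalingVariable {M : Type*} [MetricSpace M] (γ : ℝ) (q : ℝ≥0 × M × M) : ℝ :=
  dist q.2.1 q.2.2 * (q.1 : ℝ) ^ (-1 / γ)

/-- The filter on triples `(t, x, y)` with `t > 0` that describes the regime in which the scaling
variable `ρ(x, y) t ^ (-1 / γ)` converges along the filter `l`, with no other restriction on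
`t, x, y`. -/
noncomputable def scalingRegime (M : Type*) [MetricSpace M] (γ : ℝ) (l : Filter ℝ) :
    Filter (ℝ≥0 × M × M) :=
  comap (scalingVariable γ) l ⊓ 𝓟 {q | 0 < q.1}

/-!
Let `μ` be the law of `S_1` and `κ = n / α`. The law of a positive random variable is determined by
its Laplace transform, so `S_t` has the law of `t ^ (1 / β) S_1`, and the subordinated kernel is
`C₁ t ^ (-n / (α β)) Φ(z)`, where `z = ρ(x, y) t ^ (-1 / (α β))` is the scaling variable and
`Φ(z) = ∫ s ^ (-κ) F(C₂ z s ^ (-1 / α)) μ(ds)` (`subordinatedKernel_eq`). Uniformity of the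
asymptotics is thereby built in, and only the limits of `Φ` at `0` and at `∞` matter.

At `0` the limit is `F(0+) ∫ s ^ (-κ) μ(ds)` by dominated convergence, and the negative moment is
computed from the Laplace transform (`IsStableLaw.lintegral_rpow_neg`).

At `∞` the large values of `S_1` decide. With `m_x = x ^ β (1 - exp (-s)) law(S_1 / x)(ds)`, the
Laplace transforms `exp (-r ^ β)` give convergence of all integrals of `exp (-k s)` against `m_x`
as `x → ∞`, and the Weierstrass approximation theorem in the variable `exp (-s) ∈ [0, 1]` turns
this into convergence of `m_x` to the measure with density
`(1 - exp (-s)) β / Γ(1 - β) s ^ (-1 - β)`. In this way the tail of `s ^ (-κ) μ(ds)` is found to be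
regularly varying (`IsStableLaw.tendsto_tail`), without a Tauberian theorem or densities of stable
laws. Since `F` is monotone, the layer cake formula writes `Φ(z)` as an integral of such tails; they
are dominated because `μ [x, ∞) ≤ const x ^ (-β)` for every `x > 0`, and dominated convergence
yields `z ^ (n + α β) Φ(z) → β / Γ(1 - β) ∫ F(C₂ s ^ (-1 / α)) s ^ (-κ - 1 - β) ds`
(`IsStableLaw.tendsto_lintegral_rescaled`), which the substitution `u = C₂ s ^ (-1 / α)` transforms
into the stated constant.
-/

/-! ### Convergence of measures on the half-line from their Laplace transforms -/

lemma exp_neg_mem_Icc {s : ℝ} (hs : 0 ≤ s) : exp (-s) ∈ Icc (0 : ℝ) 1 :=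
  ⟨(exp_pos _).le, exp_le_one_iff.2 (by linarith)⟩

lemma integrable_exp_neg_pow {m : Measure ℝ} [IsFiniteMeasure m] (hm : ∀ᵐ s ∂m, 0 ≤ s)
    (k : ℕ) : Integrable (fun s => exp (-s) ^ k) m := by
  refine Integrable.of_bound (by fun_prop) 1 ?_
  filter_upwards [hm] with s hs
  have := exp_neg_mem_Icc hs
  rw [norm_of_nonneg (by positivity)]
  exact pow_le_one₀ this.1 this.2

lemma integral_polynomial_exp_neg {m : Measure ℝ} [IsFiniteMeasure m] (hm : ∀ᵐ s ∂m, 0 ≤ s)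
    (p : Polynomial ℝ) :
    ∫ s, p.eval (exp (-s)) ∂m
      = ∑ k ∈ Finset.range (p.natDegree + 1), p.coeff k * ∫ s, exp (-s) ^ k ∂m := by
  simp_rw [Polynomial.eval_eq_sum_range]
  rw [integral_finsetSum _ fun k _ => (integrable_exp_neg_pow hm k).const_mul _]
  simp_rw [integral_const_mul]

lemma integrable_comp_exp_neg {m : Measure ℝ} [IsFiniteMeasure m] (hm : ∀ᵐ s ∂m, 0 ≤ s)
    {φ : ℝ → ℝ} (hφ : ContinuousOn φ (Icc 0 1)) : Integrable (fun s => φ (exp (-s))) m := by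
  obtain ⟨C, hC⟩ := isCompact_Icc.exists_bound_of_continuousOn hφ
  have hm' : m.restrict (Ici 0) = m := Measure.restrict_eq_self_of_ae_mem hm
  refine Integrable.of_bound (C := C) ?_ ?_
  · rw [← hm']
    exact (hφ.comp (by fun_prop) fun s hs => exp_neg_mem_Icc hs).aestronglyMeasurable
      measurableSet_Ici
  · filter_upwards [hm] with s hs using hC _ (exp_neg_mem_Icc hs)

lemma abs_integral_sub_polynomial_le {m : Measure ℝ} [IsFiniteMeasure m] (hm : ∀ᵐ s ∂m, 0 ≤ s)
    {φ : ℝ → ℝ} (hφ : ContinuousOn φ (Icc 0 1)) (p : Polynomial ℝ) {δ : ℝ}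
    (hp : ∀ x ∈ Icc (0 : ℝ) 1, |p.eval x - φ x| < δ) :
    |∫ s, φ (exp (-s)) ∂m - ∫ s, p.eval (exp (-s)) ∂m| ≤ δ * m.real univ := by
  rw [← integral_sub (integrable_comp_exp_neg hm hφ)
    (integrable_comp_exp_neg hm (φ := fun x => p.eval x) p.continuous.continuousOn)]
  have hle : ∀ᵐ s ∂m, ‖φ (exp (-s)) - p.eval (exp (-s))‖ ≤ δ := by
    filter_upwards [hm] with s hs
    rw [Real.norm_eq_abs, abs_sub_comm]
    exact (hp _ (exp_neg_mem_Icc hs)).le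
  exact norm_integral_le_of_norm_le_const hle

/-- Convergence of all moments of `exp (-s)` implies convergence of the integrals of all
continuous functions of `exp (-s)`, by the Weierstrass approximation theorem on `[0, 1]`. The
masses stay bounded since the moment of order zero converges. -/
lemma tendsto_integral_comp_exp_neg {ι : Type*} {l : Filter ι} {m : ι → Measure ℝ}
    {m₀ : Measure ℝ} [∀ i, IsFiniteMeasure (m i)] [IsFiniteMeasure m₀]
    (hm : ∀ᶠ i in l, ∀ᵐ s ∂(m i), 0 ≤ s) (hm₀ : ∀ᵐ s ∂m₀, 0 ≤ s)
    (h : ∀ k : ℕ, Tendsto (fun i => ∫ s, exp (-s) ^ k ∂(m i)) l (𝓝 (∫ s, exp (-s) ^ k ∂m₀)))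
    {φ : ℝ → ℝ} (hφ : ContinuousOn φ (Icc 0 1)) :
    Tendsto (fun i => ∫ s, φ (exp (-s)) ∂(m i)) l (𝓝 (∫ s, φ (exp (-s)) ∂m₀)) := by
  rw [Metric.tendsto_nhds]
  intro ε hε
  -- `B` bounds the masses of `m₀` and, eventually, of `m i`.
  set B := m₀.real univ + 1 with hB
  have hB0 : 0 < B := by positivity
  obtain ⟨p, hp⟩ := exists_polynomial_near_of_continuousOn 0 1 φ hφ (ε / (3 * B)) (by positivity)
  have hpt : Tendsto (fun i => ∫ s, p.eval (exp (-s)) ∂(m i)) l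
      (𝓝 (∫ s, p.eval (exp (-s)) ∂m₀)) := by
    rw [integral_polynomial_exp_neg hm₀ p]
    refine (tendsto_finsetSum _ fun k _ => (h k).const_mul _).congr' ?_
    filter_upwards [hm] with i hi using (integral_polynomial_exp_neg hi p).symm
  have hmass : ∀ᶠ i in l, (m i).real univ < B := by
    have := h 0
    simp only [pow_zero, integral_const, smul_eq_mul, mul_one] at this
    exact this.eventually_lt_const (by linarith)
  have h3 : ε / (3 * B) * B = ε / 3 := by field_simp
  filter_upwards [hm, hmass, Metric.tendsto_nhds.1 hpt (ε / 3) (by positivity)] with i hmi hi hpi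
  rw [Real.dist_eq] at hpi ⊢
  have h1 := abs_integral_sub_polynomial_le hmi hφ p hp
  have h2 := abs_integral_sub_polynomial_le hm₀ hφ p hp
  have h1' : ε / (3 * B) * (m i).real univ ≤ ε / 3 := by
    rw [← h3]; gcongr
  have h2' : ε / (3 * B) * m₀.real univ ≤ ε / 3 := by
    rw [← h3]; gcongr; linarith
  rw [abs_le] at h1 h2
  rw [abs_lt] at hpi ⊢
  constructor <;> linarith

/-- A continuous function on `[0, ∞)` vanishing at infinity is a continuous function of
`exp (-s) ∈ [0, 1]`. -/
lemma tendsto_integral_of_tendsto_moments {ι : Type*} {l : Filter ι} {m : ι → Measure ℝ}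
    {m₀ : Measure ℝ} [∀ i, IsFiniteMeasure (m i)] [IsFiniteMeasure m₀]
    (hm : ∀ᶠ i in l, ∀ᵐ s ∂(m i), 0 ≤ s) (hm₀ : ∀ᵐ s ∂m₀, 0 ≤ s)
    (h : ∀ k : ℕ, Tendsto (fun i => ∫ s, exp (-s) ^ k ∂(m i)) l (𝓝 (∫ s, exp (-s) ^ k ∂m₀)))
    {f : ℝ → ℝ} (hf : Continuous f) (hf0 : Tendsto f atTop (𝓝 0)) :
    Tendsto (fun i => ∫ s, f s ∂(m i)) l (𝓝 (∫ s, f s ∂m₀)) := by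
  have hφ : ContinuousOn (Function.update (fun x => f (-log x)) 0 0) (Icc 0 1) := by
    intro x hx
    rcases eq_or_ne x 0 with rfl | hx0
    · rw [continuousWithinAt_update_same]
      refine hf0.comp (tendsto_neg_atBot_atTop.comp (tendsto_log_nhdsNE_zero.mono_left ?_))
      exact nhdsWithin_mono _ fun y hy => hy.2
    · rw [continuousWithinAt_update_of_ne hx0]
      exact (hf.continuousAt.comp (continuousAt_log hx0).neg).continuousWithinAt
  have key := tendsto_integral_comp_exp_neg hm hm₀ h hφ
  simpa [Function.update_of_ne (exp_pos _).ne'] using key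

/-- Uniqueness for Laplace transforms; only the transforms at positive integers matter. -/
lemma measure_eq_of_laplace_eq {m₁ m₂ : Measure ℝ} [IsProbabilityMeasure m₁]
    [IsProbabilityMeasure m₂] (h₁ : ∀ᵐ s ∂m₁, 0 ≤ s) (h₂ : ∀ᵐ s ∂m₂, 0 ≤ s)
    (h : ∀ r : ℝ, 0 < r → ∫ s, exp (-(r * s)) ∂m₁ = ∫ s, exp (-(r * s)) ∂m₂) : m₁ = m₂ := by
  have hk : ∀ k : ℕ, ∫ s, exp (-s) ^ k ∂m₁ = ∫ s, exp (-s) ^ k ∂m₂ := by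
    intro k
    rcases Nat.eq_zero_or_pos k with rfl | hk
    · simp
    · have := h k (by exact_mod_cast hk)
      simpa only [← exp_nat_mul, mul_neg] using this
  have hmap : m₁.map (fun s => exp (-s)) = m₂.map (fun s => exp (-s)) := by
    have := Measure.isProbabilityMeasure_map (μ := m₁) (f := fun s => exp (-s)) (by fun_prop)
    have := Measure.isProbabilityMeasure_map (μ := m₂) (f := fun s => exp (-s)) (by fun_prop)
    refine ext_of_forall_integral_eq_of_IsFiniteMeasure fun g => ?_
    rw [integral_map (by fun_prop) (by fun_prop), integral_map (by fun_prop) (by fun_prop)]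
    exact tendsto_nhds_unique tendsto_const_nhds (tendsto_integral_comp_exp_neg (l := atTop)
      (m := fun _ : ℕ => m₁) (.of_forall fun _ => h₁) h₂ (fun k => by
        rw [hk k]; exact tendsto_const_nhds)
      (φ := g) g.continuous.continuousOn)
  have := congrArg (Measure.map (fun x => -log x)) hmap
  rw [Measure.map_map (by fun_prop) (by fun_prop), Measure.map_map (by fun_prop) (by fun_prop)]
    at this
  have hid : (fun x => -log x) ∘ (fun s => exp (-s)) = id := by ext s; simp
  simpa [hid] using this

/-! ### The one-sided stable law -/

/-- `μ` is the law of `S_1` for a `β`-stable subordinator `S`: a probability measure on `(0, ∞)`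
with Laplace transform `exp (-r ^ β)`. -/
structure IsStableLaw (β : ℝ) (μ : Measure ℝ) : Prop where
  isProbabilityMeasure : IsProbabilityMeasure μ
  pos : ∀ᵐ s ∂μ, 0 < s
  laplace : ∀ r : ℝ, 0 < r → ∫ s, exp (-(r * s)) ∂μ = exp (-r ^ β)

lemma integrable_exp_neg_mul {μ : Measure ℝ} [IsFiniteMeasure μ] (h0 : ∀ᵐ s ∂μ, 0 ≤ s) {r : ℝ}
    (hr : 0 ≤ r) : Integrable (fun s => exp (-(r * s))) μ := by
  refine Integrable.of_bound (by fun_prop) 1 ?_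
  filter_upwards [h0] with s hs
  rw [norm_of_nonneg (exp_pos _).le, exp_le_one_iff]
  have := mul_nonneg hr hs
  linarith

/-- There is no atom at `0`, since `exp (-r ^ β)` vanishes as `r → ∞`. -/
lemma isStableLaw_of_nonneg {β : ℝ} (hβ : 0 < β) {μ : Measure ℝ} [IsProbabilityMeasure μ]
    (h0 : ∀ᵐ s ∂μ, 0 ≤ s)
    (hL : ∀ r : ℝ, 0 < r → ∫ s, exp (-(r * s)) ∂μ = exp (-r ^ β)) : IsStableLaw β μ := by
  refine ⟨inferInstance, ?_, hL⟩
  have hlim : Tendsto (fun r : ℝ => exp (-r ^ β)) atTop (𝓝 0) :=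
    tendsto_exp_neg_atTop_nhds_zero.comp (tendsto_rpow_atTop hβ)
  have hle : μ.real {0} ≤ 0 := by
    refine ge_of_tendsto hlim ?_
    filter_upwards [eventually_gt_atTop 0] with r hr
    rw [← hL r hr, ← integral_indicator_one (measurableSet_singleton (0 : ℝ))]
    refine integral_mono ((integrable_const (1 : ℝ)).indicator (measurableSet_singleton _))
      (integrable_exp_neg_mul h0 hr.le) fun s => ?_
    by_cases hs : s = 0
    · simp [hs]
    · simp [hs, (exp_pos _).le]
  have hz : μ {0} = 0 := by
    rw [← measureReal_eq_zero_iff]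
    exact le_antisymm hle measureReal_nonneg
  have hne : ∀ᵐ s ∂μ, s ≠ 0 := measure_eq_zero_iff_ae_notMem.1 hz
  filter_upwards [h0, hne] with s hs hs0 using lt_of_le_of_ne hs hs0.symm

lemma lintegral_rpow_mul_exp_neg_mul {a r : ℝ} (ha : 0 < a) (hr : 0 < r) :
    ∫⁻ t in Ioi (0 : ℝ), ENNReal.ofReal (t ^ (a - 1) * exp (-(r * t)))
      = ENNReal.ofReal (r ^ (-a) * Gamma a) := by
  have hI := Real.integral_rpow_mul_exp_neg_mul_Ioi ha hr
  have hpos : 0 < (1 / r) ^ a * Gamma a := by have := Gamma_pos_of_pos ha; positivity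
  rw [← ofReal_integral_eq_lintegral_ofReal, hI, one_div, inv_rpow hr.le, rpow_neg hr.le]
  · by_contra hni
    rw [integral_undef hni] at hI
    exact hpos.ne hI
  · filter_upwards [ae_restrict_mem measurableSet_Ioi] with t ht
    have : (0 : ℝ) < t := ht
    positivity

namespace IsStableLaw

variable {β : ℝ} {μ : Measure ℝ}

lemma ae_nonneg (hμ : IsStableLaw β μ) : ∀ᵐ s ∂μ, 0 ≤ s := hμ.pos.mono fun _ h => h.le

lemma lintegral_laplace (hμ : IsStableLaw β μ) {r : ℝ} (hr : 0 < r) :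
    ∫⁻ s, ENNReal.ofReal (exp (-(r * s))) ∂μ = ENNReal.ofReal (exp (-r ^ β)) := by
  have := hμ.isProbabilityMeasure
  rw [← hμ.laplace r hr, ofReal_integral_eq_lintegral_ofReal
    (integrable_exp_neg_mul hμ.ae_nonneg hr.le) (ae_of_all _ fun s => (exp_pos _).le)]

/-- The negative moments, from `s ^ (-κ) Γ(κ) = ∫ r ^ (κ - 1) exp (-r s) dr` and Tonelli. -/
lemma lintegral_rpow_neg (hμ : IsStableLaw β μ) (hβ : 0 < β) {κ : ℝ} (hκ : 0 < κ) :
    ∫⁻ s, ENNReal.ofReal (s ^ (-κ)) ∂μ = ENNReal.ofReal (Gamma (κ / β) / (β * Gamma κ)) := by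
  have := hμ.isProbabilityMeasure
  have hG := Gamma_pos_of_pos hκ
  have h1 : ∫⁻ s, ENNReal.ofReal (s ^ (-κ)) * ENNReal.ofReal (Gamma κ) ∂μ
      = ENNReal.ofReal (1 / β * Gamma (κ / β)) := by
    calc ∫⁻ s, ENNReal.ofReal (s ^ (-κ)) * ENNReal.ofReal (Gamma κ) ∂μ
        = ∫⁻ s, (∫⁻ r in Ioi (0 : ℝ), ENNReal.ofReal (r ^ (κ - 1) * exp (-(s * r)))) ∂μ := by
          refine lintegral_congr_ae ?_
          filter_upwards [hμ.pos] with s hs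
          rw [lintegral_rpow_mul_exp_neg_mul hκ hs, ENNReal.ofReal_mul (by positivity)]
      _ = ∫⁻ r in Ioi (0 : ℝ), ∫⁻ s, ENNReal.ofReal (r ^ (κ - 1) * exp (-(s * r))) ∂μ := by
          refine lintegral_lintegral_swap (Measurable.aemeasurable ?_)
          unfold Function.uncurry
          fun_prop
      _ = ∫⁻ r in Ioi (0 : ℝ), ENNReal.ofReal (r ^ (κ - 1) * exp (-r ^ β)) := by
          refine setLIntegral_congr_fun measurableSet_Ioi fun r (hr : 0 < r) => ?_
          simp only [ENNReal.ofReal_mul (rpow_nonneg hr.le (κ - 1))]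
          rw [lintegral_const_mul _ (by fun_prop), ← hμ.lintegral_laplace hr]
          simp_rw [mul_comm r]
      _ = ENNReal.ofReal (1 / β * Gamma (κ / β)) := by
          have hI := integral_rpow_mul_exp_neg_rpow (p := β) (q := κ - 1) hβ (by linarith)
          rw [sub_add_cancel] at hI
          rw [← hI, ofReal_integral_eq_lintegral_ofReal]
          · by_contra hni
            rw [integral_undef hni] at hI
            have := Gamma_pos_of_pos (div_pos hκ hβ)
            exact (show 0 < 1 / β * Gamma (κ / β) by positivity).ne hI
          · filter_upwards [ae_restrict_mem measurableSet_Ioi] with t ht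
            have : (0 : ℝ) < t := ht
            positivity
  rw [lintegral_mul_const _ (by fun_prop)] at h1
  rw [← ENNReal.mul_left_inj (c := ENNReal.ofReal (Gamma κ)) (by simpa using hG) (by simp), h1,
    ← ENNReal.ofReal_mul (by have := Gamma_pos_of_pos (div_pos hκ hβ); positivity)]
  congr 1
  field_simp

lemma integrable_rpow_neg (hμ : IsStableLaw β μ) (hβ : 0 < β) {κ : ℝ} (hκ : 0 < κ) :
    Integrable (fun s => s ^ (-κ)) μ := by
  refine ⟨by fun_prop, ?_⟩
  rw [hasFiniteIntegral_iff_ofReal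
    (hμ.pos.mono fun s hs => rpow_nonneg (le_of_lt hs) _), hμ.lintegral_rpow_neg hβ hκ]
  exact ENNReal.ofReal_lt_top

lemma integral_rpow_neg (hμ : IsStableLaw β μ) (hβ : 0 < β) {κ : ℝ} (hκ : 0 < κ) :
    ∫ s, s ^ (-κ) ∂μ = Gamma (κ / β) / (β * Gamma κ) := by
  rw [integral_eq_lintegral_of_nonneg_ae (hμ.pos.mono fun s hs => rpow_nonneg (le_of_lt hs) _)
    (by fun_prop), hμ.lintegral_rpow_neg hβ hκ, ENNReal.toReal_ofReal]
  have := Gamma_pos_of_pos hκ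
  have := Gamma_pos_of_pos (div_pos hκ hβ)
  positivity

/-- Markov's inequality for `1 - exp (-s / x)`. -/
lemma measureReal_Ici_le (hμ : IsStableLaw β μ) {x : ℝ} (hx : 0 < x) :
    μ.real (Ici x) ≤ (1 - exp (-1))⁻¹ * x ^ (-β) := by
  have := hμ.isProbabilityMeasure
  have he : 0 < 1 - exp (-1 : ℝ) := by
    have : exp (-1 : ℝ) < 1 := by rw [exp_lt_one_iff]; norm_num
    linarith
  rw [le_inv_mul_iff₀ he]
  have hint := integrable_exp_neg_mul hμ.ae_nonneg (inv_pos.2 hx).le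
  have hle : (1 - exp (-1)) * μ.real (Ici x) ≤ ∫ s, (1 - exp (-(x⁻¹ * s))) ∂μ := by
    rw [← integral_indicator_one measurableSet_Ici, ← integral_const_mul]
    refine integral_mono_ae (((integrable_const (1 : ℝ)).indicator measurableSet_Ici).const_mul _)
      ((integrable_const _).sub hint) ?_
    filter_upwards [hμ.pos] with s hs
    have hxs : 0 < x⁻¹ * s := by positivity
    by_cases h : x ≤ s
    · have : 1 ≤ x⁻¹ * s := by rwa [le_inv_mul_iff₀ hx, mul_one]
      have : exp (-(x⁻¹ * s)) ≤ exp (-1) := exp_le_exp.2 (by linarith)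
      simp only [indicator_of_mem (mem_Ici.2 h), Pi.one_apply]
      linarith
    · simpa [h] using hxs.le
  refine hle.trans ?_
  rw [integral_sub (integrable_const _) hint, hμ.laplace _ (inv_pos.2 hx), inv_rpow hx.le,
    ← rpow_neg hx.le]
  have := add_one_le_exp (-x ^ (-β))
  simp only [integral_const, probReal_univ, smul_eq_mul, mul_one]
  linarith

end IsStableLaw

/-- The Lévy measure `β / Γ(1 - β) s ^ (-1 - β) ds` of the stable subordinator, tested on
differences of exponentials, from `exp (-k s) - exp (-(k + 1) s) = ∫ s exp (-r s) dr` over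
`k < r < k + 1` and Tonelli. -/
lemma lintegral_exp_sub_exp {β : ℝ} (hβ₀ : 0 < β) (hβ₁ : β < 1) {k : ℝ} (hk : 0 ≤ k) :
    ∫⁻ s in Ioi (0 : ℝ), ENNReal.ofReal ((exp (-(k * s)) - exp (-((k + 1) * s)))
      * (β / Gamma (1 - β) * s ^ (-1 - β))) = ENNReal.ofReal ((k + 1) ^ β - k ^ β) := by
  have hG : 0 < Gamma (1 - β) := Gamma_pos_of_pos (by linarith)
  have hc : 0 < β / Gamma (1 - β) := by positivity
  calc _ = ∫⁻ s in Ioi (0 : ℝ), ∫⁻ r in Ioc k (k + 1),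
          ENNReal.ofReal (β / Gamma (1 - β) * (s ^ ((1 - β) - 1) * exp (-(r * s)))) := by
        refine setLIntegral_congr_fun measurableSet_Ioi fun s (hs : 0 < s) => ?_
        have hint : ∫ r in k..(k + 1), β / Gamma (1 - β) * (s ^ ((1 - β) - 1) * exp (-(r * s)))
            = (exp (-(k * s)) - exp (-((k + 1) * s))) * (β / Gamma (1 - β) * s ^ (-1 - β)) := by
          have hder : ∀ r ∈ uIcc k (k + 1), HasDerivAt
              (fun r => -(exp (-(r * s)) * (β / Gamma (1 - β) * s ^ (-1 - β))))
              (β / Gamma (1 - β) * (s ^ ((1 - β) - 1) * exp (-(r * s)))) r := by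
            intro r _
            have h := ((((hasDerivAt_id r).mul_const s).neg.exp).mul_const
              (β / Gamma (1 - β) * s ^ (-1 - β))).neg
            refine h.congr_deriv ?_
            have : s ^ ((1 - β) - 1) = s ^ (-1 - β) * s := by
              rw [← rpow_add_one hs.ne']; ring_nf
            rw [this]
            simp only [id, one_mul, Pi.neg_apply]
            ring
          rw [intervalIntegral.integral_eq_sub_of_hasDerivAt hder
            (Continuous.intervalIntegrable (by fun_prop) _ _)]
          ring
        rw [← hint, intervalIntegral.integral_of_le (by linarith),
          ofReal_integral_eq_lintegral_ofReal]
        · exact Continuous.integrableOn_Ioc (by fun_prop)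
        · exact ae_of_all _ fun r => by positivity
    _ = ∫⁻ r in Ioc k (k + 1), ∫⁻ s in Ioi (0 : ℝ),
          ENNReal.ofReal (β / Gamma (1 - β) * (s ^ ((1 - β) - 1) * exp (-(r * s)))) := by
        refine lintegral_lintegral_swap (Measurable.aemeasurable ?_)
        unfold Function.uncurry
        fun_prop
    _ = ∫⁻ r in Ioc k (k + 1), ENNReal.ofReal (β * r ^ (β - 1)) := by
        refine setLIntegral_congr_fun measurableSet_Ioc fun r hr => ?_
        have hr0 : 0 < r := hk.trans_lt hr.1
        simp only [ENNReal.ofReal_mul hc.le]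
        rw [lintegral_const_mul _ (by fun_prop),
          lintegral_rpow_mul_exp_neg_mul (by linarith) hr0, ← ENNReal.ofReal_mul hc.le]
        congr 1
        rw [show -(1 - β) = β - 1 by ring]
        field_simp
    _ = ENNReal.ofReal ((k + 1) ^ β - k ^ β) := by
        have hii : IntervalIntegrable (fun r : ℝ => β * r ^ (β - 1)) volume k (k + 1) :=
          (intervalIntegral.intervalIntegrable_rpow' (by linarith)).const_mul _
        rw [← ofReal_integral_eq_lintegral_ofReal
          ((intervalIntegrable_iff_integrableOn_Ioc_of_le (by linarith)).1 hii),
          ← intervalIntegral.integral_of_le (by linarith), intervalIntegral.integral_const_mul,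
          integral_rpow (Or.inl (by linarith)), sub_add_cancel]
        · congr 1
          field_simp
        · filter_upwards [ae_restrict_mem measurableSet_Ioc] with r hr
          have : 0 < r := hk.trans_lt hr.1
          positivity

/-! ### Tails of the stable law -/

/-- The image of `μ` under `s ↦ s / x`, with density `1 - exp (-s)` and total factor `x ^ β`. For
a `β`-stable law the factor `x ^ β` makes the part away from `0` converge, and the density makes
the masses near `0` bounded. -/
noncomputable def rescaledMeasure (β : ℝ) (μ : Measure ℝ) (x : ℝ) : Measure ℝ :=
  ENNReal.ofReal (x ^ β) •
    (μ.map (· / x)).withDensity fun s => ENNReal.ofReal (1 - exp (-s))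

/-- The limit of `rescaledMeasure`: the Lévy measure of the stable subordinator, with density
`1 - exp (-s)`. -/
noncomputable def dampedLevyMeasure (β : ℝ) : Measure ℝ :=
  (volume.restrict (Ioi 0)).withDensity fun s =>
    ENNReal.ofReal ((1 - exp (-s)) * (β / Gamma (1 - β) * s ^ (-1 - β)))

lemma one_sub_exp_neg_pos {s : ℝ} (hs : 0 < s) : 0 < 1 - exp (-s) := by
  have : exp (-s) < 1 := by rw [exp_lt_one_iff]; linarith
  linarith

instance (β : ℝ) (μ : Measure ℝ) [IsFiniteMeasure μ] (x : ℝ) :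
    IsFiniteMeasure (rescaledMeasure β μ x) := by
  have : IsFiniteMeasure
      ((μ.map (· / x)).withDensity fun s => ENNReal.ofReal (1 - exp (-s))) := by
    refine isFiniteMeasure_withDensity (ne_top_of_le_ne_top (b := ∫⁻ _, 1 ∂(μ.map (· / x))) ?_ ?_)
    · simp
    · refine lintegral_mono fun s => ENNReal.ofReal_le_one.2 ?_
      linarith [exp_pos (-s)]
  unfold rescaledMeasure
  exact Measure.smul_finite _ ENNReal.ofReal_ne_top

lemma isFiniteMeasure_dampedLevyMeasure {β : ℝ} (hβ₀ : 0 < β) (hβ₁ : β < 1) :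
    IsFiniteMeasure (dampedLevyMeasure β) := by
  refine isFiniteMeasure_withDensity ?_
  have := lintegral_exp_sub_exp hβ₀ hβ₁ le_rfl
  simp only [zero_mul, neg_zero, exp_zero, zero_add, one_mul] at this
  rw [this]
  exact ENNReal.ofReal_ne_top

lemma ae_dampedLevyMeasure (β : ℝ) : ∀ᵐ s ∂(dampedLevyMeasure β), 0 ≤ s := by
  refine (withDensity_absolutelyContinuous _ _).ae_le ?_
  filter_upwards [ae_restrict_mem measurableSet_Ioi] with s hs using (le_of_lt hs)

lemma integral_dampedLevyMeasure {β : ℝ} (hβ₀ : 0 < β) (hβ₁ : β < 1) (f : ℝ → ℝ) :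
    ∫ s, f s ∂(dampedLevyMeasure β)
      = ∫ s in Ioi (0 : ℝ), (1 - exp (-s)) * (β / Gamma (1 - β) * s ^ (-1 - β)) * f s := by
  have hG : 0 < Gamma (1 - β) := Gamma_pos_of_pos (by linarith)
  rw [dampedLevyMeasure, integral_withDensity_eq_integral_toReal_smul (by fun_prop) (by simp)]
  refine setIntegral_congr_fun measurableSet_Ioi fun s (hs : 0 < s) => ?_
  have := one_sub_exp_neg_pos hs
  simp only [smul_eq_mul]
  rw [ENNReal.toReal_ofReal (by positivity)]

/-- `y (exp (-a / y) - exp (-b / y)) → b - a` as `y → ∞`; this is applied with `y = x ^ β`. -/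
lemma tendsto_mul_exp_sub_exp (a b : ℝ) :
    Tendsto (fun y : ℝ => y * (exp (-(a / y)) - exp (-(b / y)))) atTop (𝓝 (b - a)) := by
  have hd : HasDerivAt (fun h : ℝ => exp (-(a * h)) - exp (-(b * h))) (b - a) 0 := by
    have h := (((hasDerivAt_id (0 : ℝ)).const_mul a).neg.exp).sub
      (((hasDerivAt_id (0 : ℝ)).const_mul b).neg.exp)
    refine h.congr_deriv ?_
    simp
    ring
  have h2 := hd.tendsto_slope_zero_right.comp tendsto_inv_atTop_nhdsGT_zero
  refine h2.congr fun y => ?_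
  simp [div_eq_mul_inv]

namespace IsStableLaw

variable {β : ℝ} {μ : Measure ℝ}

lemma ae_rescaledMeasure (hμ : IsStableLaw β μ) {x : ℝ} (hx : 0 < x) :
    ∀ᵐ s ∂(rescaledMeasure β μ x), 0 ≤ s := by
  have h : ∀ᵐ s ∂(μ.map (· / x)), 0 ≤ s := by
    rw [ae_map_iff (by fun_prop) measurableSet_Ici]
    filter_upwards [hμ.pos] with s hs
    positivity
  exact Measure.ae_smul_measure ((withDensity_absolutelyContinuous _ _).ae_le h) _

lemma integral_rescaledMeasure (hμ : IsStableLaw β μ) {x : ℝ} (hx : 0 < x) {f : ℝ → ℝ}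
    (hf : Measurable f) :
    ∫ s, f s ∂(rescaledMeasure β μ x) = x ^ β * ∫ s, (1 - exp (-(s / x))) * f (s / x) ∂μ := by
  rw [rescaledMeasure, integral_smul_measure,
    integral_withDensity_eq_integral_toReal_smul (by fun_prop) (by simp),
    ENNReal.toReal_ofReal (by positivity), smul_eq_mul, integral_map (by fun_prop) (by fun_prop)]
  congr 1
  refine integral_congr_ae ?_
  filter_upwards [hμ.pos] with s hs
  rw [smul_eq_mul, ENNReal.toReal_ofReal (one_sub_exp_neg_pos (by positivity)).le]

/-- Against `1 - exp (-s)`, the moment of order `k` is a difference of two Laplace transforms. -/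
lemma tendsto_moment_rescaledMeasure (hμ : IsStableLaw β μ) (hβ₀ : 0 < β) (hβ₁ : β < 1) (k : ℕ) :
    Tendsto (fun x => ∫ s, exp (-s) ^ k ∂(rescaledMeasure β μ x)) atTop
      (𝓝 (∫ s, exp (-s) ^ k ∂(dampedLevyMeasure β))) := by
  have := hμ.isProbabilityMeasure
  have hG : 0 < Gamma (1 - β) := Gamma_pos_of_pos (by linarith)
  have hkk : (k : ℝ) ^ β ≤ (k + 1 : ℝ) ^ β := by gcongr; linarith
  have hlim : ∫ s, exp (-s) ^ k ∂(dampedLevyMeasure β) = (k + 1 : ℝ) ^ β - (k : ℝ) ^ β := by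
    have h := lintegral_exp_sub_exp hβ₀ hβ₁ k.cast_nonneg
    rw [integral_dampedLevyMeasure hβ₀ hβ₁, integral_eq_lintegral_of_nonneg_ae,
      ← ENNReal.toReal_ofReal (sub_nonneg.2 hkk), ← h]
    · congr 1
      refine setLIntegral_congr_fun measurableSet_Ioi fun s _ => ?_
      rw [← exp_nat_mul, show -(((k : ℝ) + 1) * s) = k * -s + -s by ring, exp_add,
        show -((k : ℝ) * s) = k * -s by ring]
      congr 1
      ring
    · filter_upwards [ae_restrict_mem measurableSet_Ioi] with s (hs : 0 < s)
      have := one_sub_exp_neg_pos hs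
      positivity
    · fun_prop
  rw [hlim]
  refine ((tendsto_mul_exp_sub_exp _ _).comp (tendsto_rpow_atTop hβ₀)).congr' ?_
  filter_upwards [eventually_gt_atTop 0] with x hx
  rw [hμ.integral_rescaledMeasure hx (by fun_prop)]
  simp only [Function.comp]
  congr 1
  have hlap : ∀ r : ℝ, 0 ≤ r → ∫ s, exp (-(r / x * s)) ∂μ = exp (-(r ^ β / x ^ β)) := by
    intro r hr
    rcases hr.eq_or_lt with rfl | hr
    · simp [zero_rpow hβ₀.ne']
    · rw [hμ.laplace _ (by positivity), div_rpow hr.le hx.le]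
  rw [← hlap k k.cast_nonneg, ← hlap (k + 1) (by positivity), ← integral_sub
    (integrable_exp_neg_mul hμ.ae_nonneg (by positivity))
    (integrable_exp_neg_mul hμ.ae_nonneg (by positivity))]
  refine integral_congr_ae (ae_of_all _ fun s => ?_)
  simp only
  rw [← exp_nat_mul, show -(((k : ℝ) + 1) / x * s) = k * -(s / x) + -(s / x) by ring, exp_add,
    show -((k : ℝ) / x * s) = k * -(s / x) by ring]
  ring

/-- Vague convergence, away from `0`, of the rescaled stable law to its Lévy measure. Since
`1 - exp (-s)` is bounded below where `g` does not vanish, the weight of `rescaledMeasure` can be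
divided out. -/
lemma tendsto_integral_rescaled (hμ : IsStableLaw β μ) (hβ₀ : 0 < β) (hβ₁ : β < 1) {κ : ℝ}
    (hκ : 0 < κ) {a : ℝ} (ha : 0 < a) {g : ℝ → ℝ} (hg : Continuous g) (hg0 : ∀ s ≤ a, g s = 0)
    (hg1 : ∀ s, |g s| ≤ 1) :
    Tendsto (fun x => x ^ β * ∫ s, g (s / x) * (s / x) ^ (-κ) ∂μ) atTop
      (𝓝 (∫ s in Ioi (0 : ℝ), β / Gamma (1 - β) * s ^ (-(κ + β) - 1) * g s)) := by
  have := hμ.isProbabilityMeasure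
  have := isFiniteMeasure_dampedLevyMeasure hβ₀ hβ₁
  have hmax : ∀ s, 0 < max s a := fun s => lt_max_of_lt_right ha
  -- `max s a` in place of `s` keeps `f` continuous at `0`, and changes nothing where `g ≠ 0`.
  set f : ℝ → ℝ := fun s => g s * (max s a) ^ (-κ) / (1 - exp (-(max s a))) with hf
  have hfg : ∀ s, 0 < s → (1 - exp (-s)) * f s = g s * s ^ (-κ) := by
    intro s hs
    rcases le_total s a with h | h
    · simp [hf, hg0 s h]
    · have := one_sub_exp_neg_pos hs
      simp only [hf, max_eq_left h]
      field_simp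
  have hfc : Continuous f := by
    refine (hg.mul ?_).div (by fun_prop) fun s => (one_sub_exp_neg_pos (hmax s)).ne'
    exact (by fun_prop : Continuous fun s => max s a).rpow_const fun s => Or.inl (hmax s).ne'
  have hf0 : Tendsto f atTop (𝓝 0) := by
    have hb : Tendsto (fun s : ℝ => s ^ (-κ) / (1 - exp (-a))) atTop (𝓝 0) := by
      simpa using (tendsto_rpow_neg_atTop hκ).div_const (1 - exp (-a))
    refine squeeze_zero_norm' ?_ hb
    filter_upwards [eventually_ge_atTop a] with s hs
    have hs0 : 0 < s := ha.trans_le hs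
    have h1 := one_sub_exp_neg_pos ha
    have h2 : 1 - exp (-a) ≤ 1 - exp (-s) := by gcongr
    simp only [hf, max_eq_left hs, norm_div, norm_mul, Real.norm_eq_abs]
    rw [abs_of_pos (h1.trans_le h2), abs_of_pos (rpow_pos_of_pos hs0 _)]
    gcongr
    exact mul_le_of_le_one_left (by positivity) (hg1 s)
  have key := tendsto_integral_of_tendsto_moments (l := atTop) (m := rescaledMeasure β μ)
    ((eventually_gt_atTop 0).mono fun x hx => hμ.ae_rescaledMeasure hx) (ae_dampedLevyMeasure β)
    (hμ.tendsto_moment_rescaledMeasure hβ₀ hβ₁) hfc hf0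
  have hlim : ∫ s, f s ∂(dampedLevyMeasure β)
      = ∫ s in Ioi (0 : ℝ), β / Gamma (1 - β) * s ^ (-(κ + β) - 1) * g s := by
    rw [integral_dampedLevyMeasure hβ₀ hβ₁]
    refine setIntegral_congr_fun measurableSet_Ioi fun s (hs : 0 < s) => ?_
    have h1 : s ^ (-(κ + β) - 1) = s ^ (-1 - β) * s ^ (-κ) := by
      rw [← rpow_add hs]; ring_nf
    have h2 := hfg s hs
    simp only [h1]
    linear_combination (β / Gamma (1 - β) * s ^ (-1 - β)) * h2
  rw [← hlim]
  refine key.congr' ?_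
  filter_upwards [eventually_gt_atTop 0] with x hx
  rw [hμ.integral_rescaledMeasure hx hfc.measurable]
  congr 1
  refine integral_congr_ae ?_
  filter_upwards [hμ.pos] with s hs
  exact hfg _ (by positivity)

end IsStableLaw

lemma integral_Ioi_levyDensity {c γ a : ℝ} (hγ : 0 < γ) (ha : 0 < a) :
    ∫ s in Ioi a, c * s ^ (-γ - 1) = c * a ^ (-γ) / γ := by
  rw [integral_const_mul, integral_Ioi_rpow_of_lt (by linarith) ha, sub_add_cancel]
  field_simp

lemma integrableOn_Ioi_levyDensity {c γ a : ℝ} (hγ : 0 < γ) (ha : 0 < a) :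
    IntegrableOn (fun s => c * s ^ (-γ - 1)) (Ioi a) :=
  (integrableOn_Ioi_rpow_of_lt (by linarith) ha).const_mul c

/-- The continuous cutoff that vanishes on `(-∞, a]`, equals `1` on `[b, ∞)` and is linear in
between. -/
noncomputable def linearCutoff (a b s : ℝ) : ℝ := max 0 (min 1 ((s - a) / (b - a)))

lemma continuous_linearCutoff (a b : ℝ) : Continuous (linearCutoff a b) := by
  unfold linearCutoff
  fun_prop

lemma linearCutoff_nonneg (a b s : ℝ) : 0 ≤ linearCutoff a b s := le_max_left _ _

lemma linearCutoff_le_one (a b s : ℝ) : linearCutoff a b s ≤ 1 :=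
  max_le zero_le_one (min_le_left _ _)

lemma linearCutoff_of_le {a b s : ℝ} (hab : a < b) (hs : s ≤ a) : linearCutoff a b s = 0 :=
  max_eq_left ((min_le_right _ _).trans
    (div_nonpos_of_nonpos_of_nonneg (by linarith) (by linarith)))

lemma linearCutoff_of_ge {a b s : ℝ} (hab : a < b) (hs : b ≤ s) : linearCutoff a b s = 1 := by
  have : 1 ≤ (s - a) / (b - a) := by rw [le_div_iff₀ (by linarith)]; linarith
  rw [linearCutoff, min_eq_left this, max_eq_right zero_le_one]

lemma abs_linearCutoff_le_one (a b s : ℝ) : |linearCutoff a b s| ≤ 1 := by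
  rw [abs_of_nonneg (linearCutoff_nonneg a b s)]
  exact linearCutoff_le_one a b s

namespace IsStableLaw

variable {β : ℝ} {μ : Measure ℝ}

lemma integrable_cutoff (hμ : IsStableLaw β μ) (hβ₀ : 0 < β) {κ : ℝ} (hκ : 0 < κ) {x : ℝ}
    (hx : 0 < x) (a b : ℝ) :
    Integrable (fun s => linearCutoff a b (s / x) * (s / x) ^ (-κ)) μ := by
  have h : Integrable (fun s => (s / x) ^ (-κ)) μ := by
    refine ((hμ.integrable_rpow_neg hβ₀ hκ).div_const (x ^ (-κ))).congr ?_
    filter_upwards [hμ.pos] with s hs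
    rw [div_rpow (le_of_lt hs) hx.le]
  refine h.bdd_mul (c := 1)
    ((continuous_linearCutoff a b).comp (by fun_prop)).aestronglyMeasurable ?_
  exact ae_of_all _ fun s => abs_linearCutoff_le_one a b _

/-- Upper bound for the tail: the indicator of `[1, ∞)` lies below a continuous cutoff vanishing on
`(-∞, a]`, to which vague convergence applies. -/
lemma eventually_tail_lt (hμ : IsStableLaw β μ) (hβ₀ : 0 < β) (hβ₁ : β < 1) {κ : ℝ} (hκ : 0 < κ)
    {a : ℝ} (ha : 0 < a) (ha1 : a < 1) {u : ℝ}
    (hu : β / Gamma (1 - β) * a ^ (-(κ + β)) / (κ + β) < u) :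
    ∀ᶠ x : ℝ in atTop, x ^ (κ + β) * ∫ s in Ici x, s ^ (-κ) ∂μ < u := by
  have hG : 0 < Gamma (1 - β) := Gamma_pos_of_pos (by linarith)
  have hlim := hμ.tendsto_integral_rescaled hβ₀ hβ₁ hκ ha (continuous_linearCutoff a 1)
    (fun s hs => linearCutoff_of_le ha1 hs) (abs_linearCutoff_le_one a 1)
  have hle : ∫ s in Ioi (0 : ℝ), β / Gamma (1 - β) * s ^ (-(κ + β) - 1) * linearCutoff a 1 s
      ≤ β / Gamma (1 - β) * a ^ (-(κ + β)) / (κ + β) := by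
    rw [← integral_Ioi_levyDensity (by positivity) ha, ← inter_eq_left.2 (Ioi_subset_Ioi ha.le),
      inter_comm, ← setIntegral_indicator measurableSet_Ioi]
    refine integral_mono_of_nonneg ?_ ((integrableOn_Ioi_levyDensity
      (by positivity) ha).integrable_indicator measurableSet_Ioi).restrict ?_
    · filter_upwards [ae_restrict_mem measurableSet_Ioi] with s (hs : 0 < s)
      have := linearCutoff_nonneg a 1 s
      positivity
    · filter_upwards [ae_restrict_mem measurableSet_Ioi] with s (hs : 0 < s)
      by_cases h : a < s
      · rw [indicator_of_mem (mem_Ioi.2 h)]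
        exact mul_le_of_le_one_right (by positivity) (linearCutoff_le_one a 1 s)
      · simp [linearCutoff_of_le ha1 (not_lt.1 h), h]
  filter_upwards [hlim.eventually_lt_const (hle.trans_lt hu), eventually_gt_atTop 0] with x hx hx0
  refine lt_of_le_of_lt ?_ hx
  rw [add_comm κ, rpow_add hx0, mul_assoc, ← integral_indicator measurableSet_Ici,
    ← integral_const_mul]
  refine mul_le_mul_of_nonneg_left ?_ (by positivity)
  refine integral_mono_ae
    (((hμ.integrable_rpow_neg hβ₀ hκ).indicator measurableSet_Ici).const_mul _)
    (hμ.integrable_cutoff hβ₀ hκ hx0 a 1) ?_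
  filter_upwards [hμ.pos] with s hs
  by_cases h : x ≤ s
  · rw [indicator_of_mem (mem_Ici.2 h), linearCutoff_of_ge ha1 ((one_le_div hx0).2 h),
      div_rpow (le_of_lt hs) hx0.le, rpow_neg hx0.le κ]
    exact le_of_eq (by field_simp)
  · have := linearCutoff_nonneg a 1 (s / x)
    simp only [indicator_of_notMem (show s ∉ Ici x from h), mul_zero]
    positivity

/-- Lower bound for the tail: the indicator of `(1, ∞)` lies above a continuous cutoff equal to `1`
on `[b, ∞)`. -/
lemma eventually_lt_tail (hμ : IsStableLaw β μ) (hβ₀ : 0 < β) (hβ₁ : β < 1) {κ : ℝ} (hκ : 0 < κ)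
    {b : ℝ} (hb : 1 < b) {u : ℝ}
    (hu : u < β / Gamma (1 - β) * b ^ (-(κ + β)) / (κ + β)) :
    ∀ᶠ x : ℝ in atTop, u < x ^ (κ + β) * ∫ s in Ioi x, s ^ (-κ) ∂μ := by
  have hG : 0 < Gamma (1 - β) := Gamma_pos_of_pos (by linarith)
  have hb0 : 0 < b := by linarith
  have hlim := hμ.tendsto_integral_rescaled hβ₀ hβ₁ hκ one_pos (continuous_linearCutoff 1 b)
    (fun s hs => linearCutoff_of_le hb hs) (abs_linearCutoff_le_one 1 b)
  have hle : β / Gamma (1 - β) * b ^ (-(κ + β)) / (κ + β)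
      ≤ ∫ s in Ioi (0 : ℝ), β / Gamma (1 - β) * s ^ (-(κ + β) - 1) * linearCutoff 1 b s := by
    rw [← integral_Ioi_levyDensity (by positivity) hb0, ← inter_eq_left.2 (Ioi_subset_Ioi hb0.le),
      inter_comm, ← setIntegral_indicator measurableSet_Ioi]
    have hint : Integrable (fun s => (Ioi (1 : ℝ)).indicator
        (fun s => β / Gamma (1 - β) * s ^ (-(κ + β) - 1)) s * linearCutoff 1 b s)
        (volume.restrict (Ioi 0)) := by
      refine Integrable.mul_bdd (c := 1) ((integrableOn_Ioi_levyDensity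
        (by positivity) one_pos).integrable_indicator measurableSet_Ioi).restrict
        (continuous_linearCutoff 1 b).aestronglyMeasurable ?_
      exact ae_of_all _ fun s => abs_linearCutoff_le_one 1 b _
    refine integral_mono_ae ((integrableOn_Ioi_levyDensity
      (by positivity) hb0).integrable_indicator measurableSet_Ioi).restrict
      (hint.congr (ae_of_all _ fun s => ?_)) ?_
    · by_cases h : 1 < s
      · simp [h]
      · simp [linearCutoff_of_le hb (not_lt.1 h)]
    · filter_upwards [ae_restrict_mem measurableSet_Ioi] with s (hs : 0 < s)
      by_cases h : b < s
      · rw [indicator_of_mem (mem_Ioi.2 h), linearCutoff_of_ge hb h.le, mul_one]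
      · have := linearCutoff_nonneg 1 b s
        rw [indicator_of_notMem (show s ∉ Ioi b from h)]
        positivity
  filter_upwards [hlim.eventually_const_lt (hu.trans_le hle), eventually_gt_atTop 0] with x hx hx0
  refine lt_of_lt_of_le hx ?_
  rw [add_comm κ, rpow_add hx0, mul_assoc, ← integral_indicator measurableSet_Ioi,
    ← integral_const_mul (x ^ κ)]
  refine mul_le_mul_of_nonneg_left ?_ (by positivity)
  refine integral_mono_ae (hμ.integrable_cutoff hβ₀ hκ hx0 1 b)
    (((hμ.integrable_rpow_neg hβ₀ hκ).indicator measurableSet_Ioi).const_mul _) ?_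
  filter_upwards [hμ.pos] with s hs
  by_cases h : x < s
  · have hle := linearCutoff_le_one 1 b (s / x)
    rw [indicator_of_mem (mem_Ioi.2 h)]
    refine (mul_le_of_le_one_left (by positivity) hle).trans (le_of_eq ?_)
    rw [div_rpow (le_of_lt hs) hx0.le, rpow_neg hx0.le κ]
    field_simp
  · have h1 : s / x ≤ 1 := (div_le_one hx0).2 (not_lt.1 h)
    simp [linearCutoff_of_le hb h1, indicator_of_notMem (show s ∉ Ioi x from h)]

end IsStableLaw

/-- The measure `s ^ (-κ) μ(ds)`. -/
noncomputable def weightedLaw (κ : ℝ) (μ : Measure ℝ) : Measure ℝ :=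
  μ.withDensity fun s => ENNReal.ofReal (s ^ (-κ))

/-- The Lévy measure of the `β`-stable subordinator, with the additional density `s ^ (-κ)`. -/
noncomputable def weightedLevyMeasure (κ β : ℝ) : Measure ℝ :=
  (volume.restrict (Ioi 0)).withDensity fun s =>
    ENNReal.ofReal (β / Gamma (1 - β) * s ^ (-(κ + β) - 1))

/-- The Lévy measure has no atoms, so an interval may or may not contain its end point. -/
lemma weightedLevyMeasure_apply {κ β : ℝ} (hκ : 0 < κ) (hβ₀ : 0 < β) (hβ₁ : β < 1) {b : ℝ}
    (hb : 0 < b) {E : Set ℝ} (h₁ : Ioi b ⊆ E) (h₂ : E ⊆ Ici b) :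
    weightedLevyMeasure κ β E
      = ENNReal.ofReal (β / Gamma (1 - β) * b ^ (-(κ + β)) / (κ + β)) := by
  have hG : 0 < Gamma (1 - β) := Gamma_pos_of_pos (by linarith)
  have hEae : E =ᵐ[volume] Ioi b :=
    (h₂.eventuallyLE.trans Ioi_ae_eq_Ici.symm.le).antisymm h₁.eventuallyLE
  have hac : weightedLevyMeasure κ β ≪ volume :=
    (withDensity_absolutelyContinuous _ _).trans Measure.restrict_le_self.absolutelyContinuous
  rw [measure_congr (hac.ae_eq hEae), weightedLevyMeasure, withDensity_apply _ measurableSet_Ioi,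
    Measure.restrict_restrict measurableSet_Ioi, inter_eq_left.2 (Ioi_subset_Ioi hb.le),
    ← integral_Ioi_levyDensity (by positivity) hb, ofReal_integral_eq_lintegral_ofReal
      (integrableOn_Ioi_levyDensity (by positivity) hb)]
  filter_upwards [ae_restrict_mem measurableSet_Ioi] with s (hs : b < s)
  have : 0 < s := hb.trans hs
  positivity

namespace IsStableLaw

variable {β : ℝ} {μ : Measure ℝ}

lemma isFiniteMeasure_weightedLaw (hμ : IsStableLaw β μ) (hβ₀ : 0 < β) {κ : ℝ} (hκ : 0 < κ) :
    IsFiniteMeasure (weightedLaw κ μ) := by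
  refine isFiniteMeasure_withDensity ?_
  rw [hμ.lintegral_rpow_neg hβ₀ hκ]
  exact ENNReal.ofReal_ne_top

lemma measureReal_weightedLaw (hμ : IsStableLaw β μ) (hβ₀ : 0 < β) {κ : ℝ} (hκ : 0 < κ)
    {J : Set ℝ} (hJ : MeasurableSet J) :
    (weightedLaw κ μ).real J = ∫ s in J, s ^ (-κ) ∂μ := by
  rw [measureReal_def, weightedLaw, withDensity_apply _ hJ,
    ← ofReal_integral_eq_lintegral_ofReal (hμ.integrable_rpow_neg hβ₀ hκ).integrableOn,
    ENNReal.toReal_ofReal]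
  · exact integral_nonneg_of_ae (ae_restrict_of_ae
      (hμ.pos.mono fun s hs => rpow_nonneg (le_of_lt hs) _))
  · exact ae_restrict_of_ae (hμ.pos.mono fun s hs => rpow_nonneg (le_of_lt hs) _)

/-- Regular variation of the tail of `s ^ (-κ) μ(ds)`, for open and closed half-lines alike. -/
lemma tendsto_tail (hμ : IsStableLaw β μ) (hβ₀ : 0 < β) (hβ₁ : β < 1) {κ : ℝ} (hκ : 0 < κ)
    {J : ℝ → Set ℝ} (h₁ : ∀ x, 0 < x → Ioi x ⊆ J x) (h₂ : ∀ x, 0 < x → J x ⊆ Ici x) :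
    Tendsto (fun x => x ^ (κ + β) * (weightedLaw κ μ).real (J x)) atTop
      (𝓝 (β / Gamma (1 - β) / (κ + β))) := by
  have := hμ.isFiniteMeasure_weightedLaw hβ₀ hκ
  have hcont : ContinuousAt (fun a : ℝ => β / Gamma (1 - β) * a ^ (-(κ + β)) / (κ + β)) 1 :=
    ((continuousAt_rpow_const 1 _ (Or.inl one_ne_zero)).const_mul _).div_const _
  have h1 : β / Gamma (1 - β) * (1 : ℝ) ^ (-(κ + β)) / (κ + β) = β / Gamma (1 - β) / (κ + β) := by
    rw [one_rpow, mul_one]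
  rw [ContinuousAt, h1] at hcont
  refine tendsto_order.2 ⟨fun u hu => ?_, fun u hu => ?_⟩
  · obtain ⟨b, hbu, hb⟩ := (((hcont.mono_left (nhdsWithin_le_nhds (s := Ioi 1))).eventually_const_lt
      hu).and self_mem_nhdsWithin).exists
    filter_upwards [hμ.eventually_lt_tail hβ₀ hβ₁ hκ hb hbu, eventually_gt_atTop 0] with x hx hx0
    rw [← hμ.measureReal_weightedLaw hβ₀ hκ measurableSet_Ioi] at hx
    exact hx.trans_le (mul_le_mul_of_nonneg_left (measureReal_mono (h₁ x hx0))
      (by positivity))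
  · obtain ⟨a, hau, ha⟩ := (((hcont.mono_left (nhdsWithin_le_nhds (s := Iio 1))).eventually_lt_const
      hu).and (Ioo_mem_nhdsLT zero_lt_one)).exists
    filter_upwards [hμ.eventually_tail_lt hβ₀ hβ₁ hκ ha.1 ha.2 hau, eventually_gt_atTop 0]
      with x hx hx0
    rw [← hμ.measureReal_weightedLaw hβ₀ hκ measurableSet_Ici] at hx
    exact (mul_le_mul_of_nonneg_left (measureReal_mono (h₂ x hx0)) (by positivity)).trans_lt hx

/-- The bound on the tail at all scales, small ones included, that dominated convergence needs. -/
lemma tail_le (hμ : IsStableLaw β μ) (hβ₀ : 0 < β) {κ : ℝ} (hκ : 0 < κ) {x : ℝ} (hx : 0 < x) :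
    x ^ (κ + β) * (weightedLaw κ μ).real (Ici x) ≤ (1 - exp (-1))⁻¹ := by
  have := hμ.isProbabilityMeasure
  have h1 : ∫ s in Ici x, s ^ (-κ) ∂μ ≤ x ^ (-κ) * μ.real (Ici x) := by
    rw [mul_comm, ← smul_eq_mul, ← setIntegral_const]
    refine setIntegral_mono_on (hμ.integrable_rpow_neg hβ₀ hκ).integrableOn
      (integrable_const _).integrableOn measurableSet_Ici fun s hs => ?_
    exact rpow_le_rpow_of_nonpos hx hs (by linarith)
  have h2 := hμ.measureReal_Ici_le hx
  rw [hμ.measureReal_weightedLaw hβ₀ hκ measurableSet_Ici]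
  calc x ^ (κ + β) * ∫ s in Ici x, s ^ (-κ) ∂μ
      ≤ x ^ (κ + β) * (x ^ (-κ) * ((1 - exp (-1))⁻¹ * x ^ (-β))) := by
        gcongr
        exact h1.trans (by gcongr)
    _ = (1 - exp (-1))⁻¹ := by
        rw [rpow_add hx, rpow_neg hx.le, rpow_neg hx.le]
        field_simp

end IsStableLaw

/-! ### Integrals of monotone functions against the rescaled law -/

/-- Half-lines reaching down to `0` have infinite measure, hence an upper set of finite measure is
empty or a half-line with positive end point. -/
lemma eq_empty_or_exists_Ioi_subset {κ β : ℝ} (hκ : 0 < κ) (hβ₀ : 0 < β) (hβ₁ : β < 1)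
    {E : Set ℝ} (hE₀ : E ⊆ Ioi 0) (hE : ∀ s ∈ E, ∀ t, s ≤ t → t ∈ E)
    (hfin : weightedLevyMeasure κ β E ≠ ⊤) :
    E = ∅ ∨ ∃ b, 0 < b ∧ Ioi b ⊆ E ∧ E ⊆ Ici b := by
  have hG : 0 < Gamma (1 - β) := Gamma_pos_of_pos (by linarith)
  rcases E.eq_empty_or_nonempty with h | hne
  · exact Or.inl h
  have hbdd : BddBelow E := ⟨0, fun s hs => (hE₀ hs).le⟩
  have hsub : Ioi (sInf E) ⊆ E := fun t ht => by
    obtain ⟨s, hs, hst⟩ := exists_lt_of_csInf_lt hne ht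
    exact hE s hs t hst.le
  refine Or.inr ⟨sInf E, ?_, hsub, fun s hs => csInf_le hbdd hs⟩
  refine lt_of_le_of_ne (le_csInf hne fun s hs => (hE₀ hs).le) fun h0 => hfin ?_
  rw [← h0] at hsub
  have hlim : Tendsto (fun b : ℝ => ENNReal.ofReal
      (β / Gamma (1 - β) * b ^ (-(κ + β)) / (κ + β))) (𝓝[>] 0) (𝓝 ⊤) := by
    refine ENNReal.tendsto_ofReal_nhds_top.2 ?_
    refine Tendsto.atTop_div_const (by positivity) (Tendsto.const_mul_atTop (by positivity) ?_)
    exact tendsto_rpow_neg_nhdsGT_zero (by linarith)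
  refine top_le_iff.1 (le_of_tendsto hlim ?_)
  filter_upwards [self_mem_nhdsWithin] with b (hb : 0 < b)
  rw [← weightedLevyMeasure_apply hκ hβ₀ hβ₁ hb subset_rfl Ioi_subset_Ici_self]
  exact measure_mono ((Ioi_subset_Ioi hb.le).trans hsub)

lemma aemeasurable_of_monotoneOn_Ioi {m : Measure ℝ} (hm : ∀ᵐ s ∂m, 0 < s) {H : ℝ → ℝ}
    (hH : MonotoneOn H (Ioi 0)) : AEMeasurable H m := by
  rw [← Measure.restrict_eq_self_of_ae_mem (s := Ioi 0) hm]
  exact aemeasurable_restrict_of_monotoneOn measurableSet_Ioi hH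

lemma monotoneOn_comp_div {H : ℝ → ℝ} (hH : MonotoneOn H (Ioi 0)) {x : ℝ} (hx : 0 < x) :
    MonotoneOn (fun s => H (s / x)) (Ioi 0) := fun s hs t ht hst =>
  hH (div_pos hs hx) (div_pos ht hx) (by gcongr)

lemma ae_weightedLevyMeasure (κ β : ℝ) : ∀ᵐ s ∂(weightedLevyMeasure κ β), 0 < s :=
  (withDensity_absolutelyContinuous _ _).ae_le (ae_restrict_mem measurableSet_Ioi)

namespace IsStableLaw

variable {β : ℝ} {μ : Measure ℝ}

lemma ae_weightedLaw (hμ : IsStableLaw β μ) (κ : ℝ) : ∀ᵐ s ∂(weightedLaw κ μ), 0 < s :=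
  (withDensity_absolutelyContinuous _ _).ae_le hμ.pos

/-- A multiple of the limit bounds the rescaled measure of an upper set, uniformly in the set and
in the scale. -/
lemma rescaled_upperSet_le (hμ : IsStableLaw β μ) (hβ₀ : 0 < β) (hβ₁ : β < 1) {κ : ℝ} (hκ : 0 < κ)
    {E : Set ℝ} (hE₀ : E ⊆ Ioi 0) (hE : ∀ s ∈ E, ∀ t, s ≤ t → t ∈ E) {x : ℝ} (hx : 0 < x) :
    ENNReal.ofReal (x ^ (κ + β)) * weightedLaw κ μ {s | s / x ∈ E}
      ≤ ENNReal.ofReal ((1 - exp (-1))⁻¹ * ((κ + β) / (β / Gamma (1 - β))))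
        * weightedLevyMeasure κ β E := by
  have := hμ.isFiniteMeasure_weightedLaw hβ₀ hκ
  have hG : 0 < Gamma (1 - β) := Gamma_pos_of_pos (by linarith)
  have he := one_sub_exp_neg_pos one_pos
  -- An upper set reaching down to `0` has infinite limit measure, and the bound is trivial.
  by_cases hfin : weightedLevyMeasure κ β E = ⊤
  · rw [hfin, ENNReal.mul_top]
    · exact le_top
    · simp only [ne_eq, ENNReal.ofReal_eq_zero, not_le]
      positivity
  rcases eq_empty_or_exists_Ioi_subset hκ hβ₀ hβ₁ hE₀ hE hfin with rfl | ⟨b, hb, h₁, h₂⟩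
  · simp
  rw [weightedLevyMeasure_apply hκ hβ₀ hβ₁ hb h₁ h₂, ← ENNReal.ofReal_mul (by positivity),
    ← ofReal_measureReal, ← ENNReal.ofReal_mul (by positivity)]
  refine ENNReal.ofReal_le_ofReal ?_
  have hsub : {s | s / x ∈ E} ⊆ Ici (x * b) := fun s hs => by
    have : b ≤ s / x := h₂ hs
    rwa [le_div_iff₀' hx] at this
  have hxb : x ^ (κ + β) = (x * b) ^ (κ + β) * b ^ (-(κ + β)) := by
    rw [mul_rpow hx.le hb.le, rpow_neg hb.le]
    field_simp
  calc x ^ (κ + β) * (weightedLaw κ μ).real {s | s / x ∈ E}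
      ≤ x ^ (κ + β) * (weightedLaw κ μ).real (Ici (x * b)) :=
        mul_le_mul_of_nonneg_left (measureReal_mono hsub) (by positivity)
    _ = (x * b) ^ (κ + β) * (weightedLaw κ μ).real (Ici (x * b)) * b ^ (-(κ + β)) := by
        rw [hxb]; ring
    _ ≤ (1 - exp (-1))⁻¹ * b ^ (-(κ + β)) := by
        gcongr
        exact hμ.tail_le hβ₀ hκ (by positivity)
    _ = _ := by field_simp

lemma tendsto_rescaled_upperSet (hμ : IsStableLaw β μ) (hβ₀ : 0 < β) (hβ₁ : β < 1) {κ : ℝ}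
    (hκ : 0 < κ) {E : Set ℝ} (hE₀ : E ⊆ Ioi 0) (hE : ∀ s ∈ E, ∀ t, s ≤ t → t ∈ E)
    (hfin : weightedLevyMeasure κ β E ≠ ⊤) :
    Tendsto (fun x : ℝ => ENNReal.ofReal (x ^ (κ + β)) * weightedLaw κ μ {s | s / x ∈ E}) atTop
      (𝓝 (weightedLevyMeasure κ β E)) := by
  have := hμ.isFiniteMeasure_weightedLaw hβ₀ hκ
  rcases eq_empty_or_exists_Ioi_subset hκ hβ₀ hβ₁ hE₀ hE hfin with rfl | ⟨b, hb, h₁, h₂⟩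
  · simp
  rw [weightedLevyMeasure_apply hκ hβ₀ hβ₁ hb h₁ h₂]
  have hJ := hμ.tendsto_tail hβ₀ hβ₁ hκ (J := fun y => {s | s / (y / b) ∈ E})
    (fun y hy s hs => h₁ (show b < s / (y / b) by
      rw [lt_div_iff₀ (by positivity), mul_div_cancel₀ _ hb.ne']; exact hs))
    (fun y hy s hs => by
      have : b ≤ s / (y / b) := h₂ hs
      rwa [le_div_iff₀ (by positivity), mul_div_cancel₀ _ hb.ne'] at this)
  have hlim := ENNReal.tendsto_ofReal
    ((hJ.comp (tendsto_id.atTop_mul_const hb)).const_mul (b ^ (-(κ + β))))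
  rw [show b ^ (-(κ + β)) * (β / Gamma (1 - β) / (κ + β))
    = β / Gamma (1 - β) * b ^ (-(κ + β)) / (κ + β) by ring] at hlim
  refine hlim.congr' ?_
  filter_upwards [eventually_gt_atTop 0] with x hx
  rw [← ofReal_measureReal, ← ENNReal.ofReal_mul (by positivity)]
  simp only [Function.comp, id, mul_div_cancel_right₀ _ hb.ne']
  rw [mul_rpow hx.le hb.le, rpow_neg hb.le]
  congr 1
  field_simp

/-- By the layer cake formula the integral of a monotone function is a superposition of measures
of upper sets, to which dominated convergence applies. -/
lemma tendsto_lintegral_rescaled (hμ : IsStableLaw β μ) (hβ₀ : 0 < β) (hβ₁ : β < 1) {κ : ℝ}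
    (hκ : 0 < κ) {H : ℝ → ℝ} (hH : MonotoneOn H (Ioi 0)) (hH0 : ∀ s, 0 < s → 0 ≤ H s)
    (hfin : ∫⁻ s, ENNReal.ofReal (H s) ∂(weightedLevyMeasure κ β) ≠ ⊤) :
    Tendsto (fun x : ℝ => ENNReal.ofReal (x ^ (κ + β))
        * ∫⁻ s, ENNReal.ofReal (H (s / x)) ∂(weightedLaw κ μ)) atTop
      (𝓝 (∫⁻ s, ENNReal.ofReal (H s) ∂(weightedLevyMeasure κ β))) := by
  set E : ℝ → Set ℝ := fun y => {w | 0 < w ∧ y < H w} with hEdef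
  have hE₀ : ∀ y, E y ⊆ Ioi 0 := fun y w hw => hw.1
  have hE : ∀ y, ∀ s ∈ E y, ∀ t, s ≤ t → t ∈ E y := fun y s hs t hst =>
    have ht : 0 < t := hs.1.trans_le hst
    ⟨ht, hs.2.trans_le (hH hs.1 ht hst)⟩
  have hEanti : ∀ y y', y ≤ y' → E y' ⊆ E y := fun y y' h w hw => ⟨hw.1, h.trans_lt hw.2⟩
  have hcake₀ : ∫⁻ s, ENNReal.ofReal (H s) ∂(weightedLevyMeasure κ β)
      = ∫⁻ y in Ioi (0 : ℝ), weightedLevyMeasure κ β (E y) := by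
    rw [lintegral_eq_lintegral_meas_lt _ ((ae_weightedLevyMeasure κ β).mono hH0)
      (aemeasurable_of_monotoneOn_Ioi (ae_weightedLevyMeasure κ β) hH)]
    refine lintegral_congr fun y => measure_congr ?_
    filter_upwards [ae_weightedLevyMeasure κ β] with s hs
    exact propext ⟨fun h => ⟨hs, h⟩, fun h => h.2⟩
  have hcake : ∀ x : ℝ, 0 < x → ∫⁻ s, ENNReal.ofReal (H (s / x)) ∂(weightedLaw κ μ)
      = ∫⁻ y in Ioi (0 : ℝ), weightedLaw κ μ {s | s / x ∈ E y} := by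
    intro x hx
    rw [lintegral_eq_lintegral_meas_lt _
      ((hμ.ae_weightedLaw κ).mono fun s hs => hH0 _ (div_pos hs hx))
      (aemeasurable_of_monotoneOn_Ioi (hμ.ae_weightedLaw κ) (monotoneOn_comp_div hH hx))]
    refine lintegral_congr fun y => measure_congr ?_
    filter_upwards [hμ.ae_weightedLaw κ] with s hs
    exact propext ⟨fun h => ⟨div_pos hs hx, h⟩, fun h => h.2⟩
  have hmeas : ∀ x : ℝ, Measurable fun y => weightedLaw κ μ {s | s / x ∈ E y} := fun x =>
    Antitone.measurable fun y y' h => measure_mono fun s hs => hEanti y y' h hs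
  have hmeas₀ : Measurable fun y => weightedLevyMeasure κ β (E y) :=
    Antitone.measurable fun y y' h => measure_mono (hEanti y y' h)
  rw [hcake₀] at hfin ⊢
  have key := tendsto_lintegral_filter_of_dominated_convergence (l := atTop)
    (μ := volume.restrict (Ioi (0 : ℝ)))
    (F := fun (x : ℝ) y => ENNReal.ofReal (x ^ (κ + β)) * weightedLaw κ μ {s | s / x ∈ E y})
    (f := fun y => weightedLevyMeasure κ β (E y))
    (fun y => ENNReal.ofReal ((1 - exp (-1))⁻¹ * ((κ + β) / (β / Gamma (1 - β))))
        * weightedLevyMeasure κ β (E y))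
    (.of_forall fun x => (hmeas x).const_mul _)
    ((eventually_gt_atTop 0).mono fun x hx => ae_of_all _ fun y =>
      hμ.rescaled_upperSet_le hβ₀ hβ₁ hκ (hE₀ y) (hE y) hx)
    (by
      rw [lintegral_const_mul _ hmeas₀]
      exact ENNReal.mul_ne_top ENNReal.ofReal_ne_top hfin)
    (by
      -- Levels `y` with `E y` of infinite measure form a null set since the integral is finite.
      filter_upwards [ae_lt_top hmeas₀ hfin] with y hy
      exact hμ.tendsto_rescaled_upperSet hβ₀ hβ₁ hκ (hE₀ y) (hE y) hy.ne)
  refine key.congr' ?_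
  filter_upwards [eventually_gt_atTop 0] with x hx
  rw [hcake x hx, lintegral_const_mul _ (hmeas x)]

end IsStableLaw

/-! ### The profile of the subordinated kernel -/

/-- The subordinated kernel at time `1`, divided by `C₁`, as a function of the scaled distance
`z`, with `κ = n / α` and `μ` the law of `S_1`. -/
noncomputable def stableProfile (μ : Measure ℝ) (F : ℝ → ℝ) (C κ α z : ℝ) : ℝ :=
  ∫ s, s ^ (-κ) * F (C * (z / s ^ (1 / α))) ∂μ

lemma monotoneOn_profile_integrand {F : ℝ → ℝ} (hF : AntitoneOn F (Ici 0)) {C α z : ℝ}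
    (hC : 0 < C) (hα : 0 < α) (hz : 0 ≤ z) :
    MonotoneOn (fun s => F (C * (z / s ^ (1 / α)))) (Ioi 0) := by
  intro s (hs : 0 < s) t (ht : 0 < t) hst
  refine hF ?_ ?_ ?_
  · exact mem_Ici.2 (by positivity)
  · exact mem_Ici.2 (by positivity)
  · gcongr

/-- The substitution `u = C s ^ (-1 / α)`. -/
lemma lintegral_weightedLevyMeasure_comp_rpow {F : ℝ → ℝ} (hF0 : ∀ r, 0 ≤ r → 0 < F r)
    (hF : AntitoneOn F (Ici 0)) {n α β C : ℝ} (hα : 0 < α) (hβ₀ : 0 < β) (hβ₁ : β < 1)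
    (hC : 0 < C) (hint : IntegrableOn (fun s : ℝ => s ^ (n + α * β - 1) * F s) (Ioi 0)) :
    ∫⁻ s, ENNReal.ofReal (F (C * (1 / s ^ (1 / α)))) ∂(weightedLevyMeasure (n / α) β)
      = ENNReal.ofReal (α * β / Gamma (1 - β) * C ^ (-n - α * β)
          * ∫ s in Ioi (0 : ℝ), s ^ (n + α * β - 1) * F s) := by
  have hG : 0 < Gamma (1 - β) := Gamma_pos_of_pos (by linarith)
  set G : ℝ → ℝ := fun u => u ^ (n + α * β - 1) * F u with hGdef
  have hintC : IntegrableOn (fun v => G (C * v)) (Ioi 0) := by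
    rw [integrableOn_Ioi_comp_mul_left_iff _ _ hC, mul_zero]
    exact hint
  have hp : -(1 / α) ≠ 0 := by
    have : 0 < 1 / α := by positivity
    linarith
  have hintp := (integrableOn_Ioi_comp_rpow_iff (fun v => G (C * v)) hp).2 hintC
  have hpt : ∀ s : ℝ, 0 < s → (|(-(1 / α))| * s ^ (-(1 / α) - 1)) • G (C * s ^ (-(1 / α)))
      * (α * β / Gamma (1 - β) * C ^ (-(n + α * β - 1)))
      = β / Gamma (1 - β) * s ^ (-(n / α + β) - 1) * F (C * (1 / s ^ (1 / α))) := by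
    intro s hs
    have h1 : s ^ (-(n / α + β) - 1)
        = s ^ (-(1 / α) - 1) * (s ^ (-(1 / α))) ^ (n + α * β - 1) := by
      rw [← rpow_mul hs.le, ← rpow_add hs]
      congr 1
      field_simp
      ring
    have h2 : 1 / s ^ (1 / α) = s ^ (-(1 / α)) := by rw [rpow_neg hs.le, one_div]
    rw [h1, h2, abs_neg, abs_of_pos (by positivity), hGdef]
    simp only [smul_eq_mul]
    rw [mul_rpow hC.le (by positivity), rpow_neg hC.le]
    have := rpow_pos_of_pos hC (n + α * β - 1)
    field_simp
  have hI : ∫ s in Ioi (0 : ℝ), β / Gamma (1 - β) * s ^ (-(n / α + β) - 1)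
        * F (C * (1 / s ^ (1 / α)))
      = α * β / Gamma (1 - β) * C ^ (-n - α * β) * ∫ s in Ioi (0 : ℝ), G s := by
    rw [← setIntegral_congr_fun measurableSet_Ioi fun s hs => hpt s hs, integral_mul_const,
      integral_comp_rpow_Ioi (fun v => G (C * v)) hp, integral_comp_mul_left_Ioi G 0 hC, mul_zero,
      smul_eq_mul, show -n - α * β = -(n + α * β - 1) - 1 by ring, rpow_sub_one hC.ne']
    field_simp
  have hInt : IntegrableOn (fun s => β / Gamma (1 - β) * s ^ (-(n / α + β) - 1)
      * F (C * (1 / s ^ (1 / α)))) (Ioi 0) :=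
    IntegrableOn.congr_fun (hintp.mul_const _) (fun s hs => hpt s hs) measurableSet_Ioi
  have hmono := monotoneOn_profile_integrand hF hC hα zero_le_one
  have hH : AEMeasurable (fun s => ENNReal.ofReal (F (C * (1 / s ^ (1 / α)))))
      (weightedLevyMeasure (n / α) β) :=
    (aemeasurable_of_monotoneOn_Ioi (ae_weightedLevyMeasure _ _) hmono).ennreal_ofReal
  rw [← hI, ofReal_integral_eq_lintegral_ofReal hInt, weightedLevyMeasure,
    lintegral_withDensity_eq_lintegral_mul₀' (by fun_prop) hH]
  · refine setLIntegral_congr_fun measurableSet_Ioi fun s (hs : 0 < s) => ?_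
    exact (ENNReal.ofReal_mul (by positivity)).symm
  · filter_upwards [ae_restrict_mem measurableSet_Ioi] with s (hs : 0 < s)
    have := hF0 (C * (1 / s ^ (1 / α))) (by positivity)
    positivity

namespace IsStableLaw

variable {β : ℝ} {μ : Measure ℝ}

lemma integrable_profile (hμ : IsStableLaw β μ) (hβ₀ : 0 < β) {κ : ℝ} (hκ : 0 < κ) {F : ℝ → ℝ}
    (hF0 : ∀ r, 0 ≤ r → 0 < F r) (hF : AntitoneOn F (Ici 0)) {C α z : ℝ} (hC : 0 < C) (hα : 0 < α)
    (hz : 0 ≤ z) : Integrable (fun s => s ^ (-κ) * F (C * (z / s ^ (1 / α)))) μ := by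
  refine (hμ.integrable_rpow_neg hβ₀ hκ).mul_bdd (c := F 0) (aemeasurable_of_monotoneOn_Ioi hμ.pos
    (monotoneOn_profile_integrand hF hC hα hz)).aestronglyMeasurable ?_
  filter_upwards [hμ.pos] with s hs
  have h : 0 ≤ C * (z / s ^ (1 / α)) := by positivity
  rw [norm_of_nonneg (hF0 _ h).le]
  exact hF self_mem_Ici h h

/-- The profile at infinity; `z ^ α` is the scale at which the law of `S_1` is viewed. -/
lemma tendsto_rpow_mul_profile (hμ : IsStableLaw β μ) (hβ₀ : 0 < β) (hβ₁ : β < 1) {F : ℝ → ℝ}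
    (hF0 : ∀ r, 0 ≤ r → 0 < F r) (hF : AntitoneOn F (Ici 0)) {n α C : ℝ} (hn : 0 < n) (hC : 0 < C)
    (hα : 0 < α) (hint : IntegrableOn (fun s : ℝ => s ^ (n + α * β - 1) * F s) (Ioi 0)) :
    Tendsto (fun z => z ^ (n + α * β) * stableProfile μ F C (n / α) α z) atTop
      (𝓝 (α * β / Gamma (1 - β) * C ^ (-n - α * β)
        * ∫ s in Ioi (0 : ℝ), s ^ (n + α * β - 1) * F s)) := by
  have hG : 0 < Gamma (1 - β) := Gamma_pos_of_pos (by linarith)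
  have hval := lintegral_weightedLevyMeasure_comp_rpow hF0 hF hα hβ₀ hβ₁ hC hint
  have hHmono := monotoneOn_profile_integrand hF hC hα zero_le_one
  have hHpos : ∀ s : ℝ, 0 < s → 0 ≤ F (C * (1 / s ^ (1 / α))) := fun s hs =>
    (hF0 _ (by positivity)).le
  have h := hμ.tendsto_lintegral_rescaled hβ₀ hβ₁ (div_pos hn hα) hHmono hHpos
    (by rw [hval]; exact ENNReal.ofReal_ne_top)
  rw [hval] at h
  have hI : 0 ≤ ∫ s in Ioi (0 : ℝ), s ^ (n + α * β - 1) * F s :=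
    setIntegral_nonneg measurableSet_Ioi fun s (hs : 0 < s) => by
      have := hF0 s hs.le
      positivity
  have h2 := (ENNReal.tendsto_toReal ENNReal.ofReal_ne_top).comp
    (h.comp (tendsto_rpow_atTop hα))
  rw [ENNReal.toReal_ofReal (by positivity)] at h2
  refine h2.congr' ?_
  filter_upwards [eventually_gt_atTop 0] with z hz
  have hzα : 0 < z ^ α := by positivity
  have hmeas := aemeasurable_of_monotoneOn_Ioi (hμ.ae_weightedLaw (n / α))
    (monotoneOn_comp_div hHmono hzα)
  have hnonneg : ∀ᵐ s ∂(weightedLaw (n / α) μ), 0 ≤ F (C * (1 / (s / z ^ α) ^ (1 / α))) :=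
    (hμ.ae_weightedLaw (n / α)).mono fun s hs => hHpos _ (div_pos hs hzα)
  simp only [Function.comp]
  rw [ENNReal.toReal_mul, ENNReal.toReal_ofReal (by positivity),
    ← integral_eq_lintegral_of_nonneg_ae hnonneg hmeas.aestronglyMeasurable, ← rpow_mul hz.le,
    weightedLaw, integral_withDensity_eq_integral_toReal_smul (by fun_prop) (by simp)]
  congr 1
  · congr 1
    field_simp
  · refine integral_congr_ae ?_
    filter_upwards [hμ.pos] with s hs
    rw [ENNReal.toReal_ofReal (by positivity), smul_eq_mul, div_rpow (le_of_lt hs) hzα.le,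
      ← rpow_mul hz.le, mul_one_div_cancel hα.ne', rpow_one, one_div_div]

/-- With `K = (0, ∞)` this is the limit off the diagonal, with `K = [0, ∞)` the limit with the
diagonal included. -/
lemma tendsto_profile_zero (hμ : IsStableLaw β μ) (hβ₀ : 0 < β) {κ : ℝ} (hκ : 0 < κ) {F : ℝ → ℝ}
    (hF0 : ∀ r, 0 ≤ r → 0 < F r) (hF : AntitoneOn F (Ici 0)) {C α : ℝ} (hC : 0 < C) (hα : 0 < α)
    {K : Set ℝ} (hK₀ : K ⊆ Ici 0) (hK : ∀ c, 0 < c → ∀ z ∈ K, c * z ∈ K) {A : ℝ}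
    (hA : Tendsto F (𝓝[K] 0) (𝓝 A)) :
    Tendsto (stableProfile μ F C κ α) (𝓝[K] 0) (𝓝 (A * (Gamma (κ / β) / (β * Gamma κ)))) := by
  rw [← hμ.integral_rpow_neg hβ₀ hκ, mul_comm, ← integral_mul_const]
  refine tendsto_integral_filter_of_dominated_convergence (fun s => s ^ (-κ) * F 0) ?_ ?_
    ((hμ.integrable_rpow_neg hβ₀ hκ).mul_const _) ?_
  · filter_upwards [self_mem_nhdsWithin] with z hz
    exact (hμ.integrable_profile hβ₀ hκ hF0 hF hC hα (hK₀ hz)).aestronglyMeasurable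
  · filter_upwards [self_mem_nhdsWithin] with z hz
    have hz0 : 0 ≤ z := hK₀ hz
    filter_upwards [hμ.pos] with s hs
    have h : 0 ≤ C * (z / s ^ (1 / α)) := by positivity
    rw [norm_mul, norm_of_nonneg (by positivity), norm_of_nonneg (hF0 _ h).le]
    gcongr
    exact hF self_mem_Ici h h
  · filter_upwards [hμ.pos] with s hs
    refine (hA.comp (tendsto_nhdsWithin_iff.2 ⟨?_, ?_⟩)).const_mul _
    · have : Tendsto (fun z => C * (z / s ^ (1 / α))) (𝓝 0) (𝓝 (C * (0 / s ^ (1 / α)))) :=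
        (tendsto_id.div_const _).const_mul _
      rw [zero_div, mul_zero] at this
      exact this.mono_left nhdsWithin_le_nhds
    · filter_upwards [self_mem_nhdsWithin] with z hz
      rw [show C * (z / s ^ (1 / α)) = C / s ^ (1 / α) * z by ring]
      exact hK _ (by positivity) z hz

end IsStableLaw

/-! ### Scaling of the subordinated kernel -/

lemma IsStableSubordinator.ae_nonneg {Ω : Type*} [MeasurableSpace Ω] {P : Measure Ω} {β : ℝ}
    {S : ℝ≥0 → Ω → ℝ} (hS : IsStableSubordinator P β S) (t : ℝ≥0) :
    ∀ᵐ s ∂(P.map (S t)), 0 ≤ s := by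
  rw [ae_map_iff (hS.measurable t).aemeasurable measurableSet_Ici]
  filter_upwards [hS.start_zero, hS.nondecreasing] with ω h0 hmono
  have h : S 0 ω ≤ S t ω := hmono (show 0 ≤ t from zero_le)
  exact h0 ▸ h

lemma IsStableSubordinator.integral_exp_map {Ω : Type*} [MeasurableSpace Ω] {P : Measure Ω}
    {β : ℝ} {S : ℝ≥0 → Ω → ℝ} (hS : IsStableSubordinator P β S) (t : ℝ≥0) {r : ℝ} (hr : 0 < r) :
    ∫ s, exp (-(r * s)) ∂(P.map (S t)) = exp (-((t : ℝ) * r ^ β)) := by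
  rw [integral_map (hS.measurable t).aemeasurable (by fun_prop), hS.laplace r hr t]

lemma IsStableSubordinator.isStableLaw {Ω : Type*} [MeasurableSpace Ω] {P : Measure Ω}
    [IsProbabilityMeasure P] {β : ℝ} (hβ : 0 < β) {S : ℝ≥0 → Ω → ℝ}
    (hS : IsStableSubordinator P β S) : IsStableLaw β (P.map (S 1)) := by
  have := Measure.isProbabilityMeasure_map (μ := P) (hS.measurable 1).aemeasurable
  refine isStableLaw_of_nonneg hβ (hS.ae_nonneg 1) fun r hr => ?_
  simpa using hS.integral_exp_map 1 hr

/-- Self-similarity: `S_t` has the law of `t ^ (1 / β) S_1`. -/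
lemma IsStableSubordinator.map_eq {Ω : Type*} [MeasurableSpace Ω] {P : Measure Ω}
    [IsProbabilityMeasure P] {β : ℝ} (hβ : 0 < β) {S : ℝ≥0 → Ω → ℝ}
    (hS : IsStableSubordinator P β S) {t : ℝ≥0} (ht : 0 < t) :
    P.map (S t) = (P.map (S 1)).map (fun s => (t : ℝ) ^ (1 / β) * s) := by
  have ht' : (0 : ℝ) < t := by exact_mod_cast ht
  have := Measure.isProbabilityMeasure_map (μ := P) (hS.measurable 1).aemeasurable
  have := Measure.isProbabilityMeasure_map (μ := P) (hS.measurable t).aemeasurable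
  have := Measure.isProbabilityMeasure_map (μ := P.map (S 1))
    (f := fun s => (t : ℝ) ^ (1 / β) * s) (by fun_prop)
  refine measure_eq_of_laplace_eq (hS.ae_nonneg t) ?_ fun r hr => ?_
  · rw [ae_map_iff (by fun_prop) measurableSet_Ici]
    filter_upwards [hS.ae_nonneg 1] with s hs
    positivity
  · rw [hS.integral_exp_map t hr, integral_map (by fun_prop) (by fun_prop)]
    simp_rw [← mul_assoc]
    rw [hS.integral_exp_map 1 (by positivity), mul_rpow hr.le (by positivity), ← rpow_mul ht'.le,
      one_div_mul_cancel hβ.ne', rpow_one, NNReal.coe_one, one_mul, mul_comm (r ^ β)]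

lemma scalingVariable_nonneg {M : Type*} [MetricSpace M] (γ : ℝ) (q : ℝ≥0 × M × M) :
    0 ≤ scalingVariable γ q := by
  unfold scalingVariable
  positivity

section Kernel

variable {M : Type*} [MetricSpace M] {n α C₁ C₂ : ℝ} {F : ℝ → ℝ} {p : ℝ → M → M → ℝ} {β : ℝ}

lemma kernel_scaled (hα : 0 < α) (hβ : 0 < β)
    (hp : ∀ t, 0 < t → ∀ x y : M,
      p t x y = C₁ / t ^ (n / α) * F (C₂ * (dist x y / t ^ (1 / α))))
    {t : ℝ≥0} (ht : 0 < t) (x y : M) {s : ℝ} (hs : 0 < s) :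
    p ((t : ℝ) ^ (1 / β) * s) x y = C₁ * (t : ℝ) ^ (-n / (α * β))
      * (s ^ (-(n / α)) * F (C₂ * (scalingVariable (α * β) (t, x, y) / s ^ (1 / α)))) := by
  have ht' : (0 : ℝ) < t := by exact_mod_cast ht
  rw [hp _ (by positivity), mul_rpow (by positivity) hs.le, mul_rpow (by positivity) hs.le,
    ← rpow_mul ht'.le, ← rpow_mul ht'.le, scalingVariable,
    show -n / (α * β) = -(1 / β * (n / α)) by field_simp,
    show -1 / (α * β) = -(1 / β * (1 / α)) by field_simp, rpow_neg ht'.le, rpow_neg ht'.le,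
    rpow_neg hs.le]
  rw [show dist x y / ((t : ℝ) ^ (1 / β * (1 / α)) * s ^ (1 / α))
    = dist x y * ((t : ℝ) ^ (1 / β * (1 / α)))⁻¹ / s ^ (1 / α) by field_simp]
  field_simp

variable {Ω : Type*} [MeasurableSpace Ω] {P : Measure Ω} [IsProbabilityMeasure P]
  {S : ℝ≥0 → Ω → ℝ}

lemma restrict_Ioi_map (hβ : 0 < β) (hS : IsStableSubordinator P β S) {t : ℝ≥0} (ht : 0 < t) :
    (P.map (S t)).restrict (Ioi 0) = P.map (S t) := by
  have ht' : (0 : ℝ) < t := by exact_mod_cast ht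
  have h : ∀ᵐ s ∂(P.map (S t)), 0 < s := by
    rw [hS.map_eq hβ ht, ae_map_iff (by fun_prop) measurableSet_Ioi]
    filter_upwards [(hS.isStableLaw hβ).pos] with s hs
    positivity
  exact Measure.restrict_eq_self_of_ae_mem h

lemma integrableOn_kernel (hn : 0 < n) (hα : 0 < α) (hC₂ : 0 < C₂)
    (hF_pos : ∀ r, 0 ≤ r → 0 < F r) (hF_anti : AntitoneOn F (Ici 0))
    (hp : ∀ t, 0 < t → ∀ x y : M,
      p t x y = C₁ / t ^ (n / α) * F (C₂ * (dist x y / t ^ (1 / α))))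
    (hβ : 0 < β) (hS : IsStableSubordinator P β S) {t : ℝ≥0} (ht : 0 < t) (x y : M) :
    IntegrableOn (fun s => p s x y) (Ioi 0) (P.map (S t)) := by
  have ht' : (0 : ℝ) < (t : ℝ) ^ (1 / β) := rpow_pos_of_pos (by exact_mod_cast ht) _
  rw [IntegrableOn, restrict_Ioi_map hβ hS ht, hS.map_eq hβ ht,
    (measurableEmbedding_mulLeft₀ ht'.ne').integrable_map_iff]
  refine (((hS.isStableLaw hβ).integrable_profile hβ (div_pos hn hα) hF_pos hF_anti hC₂ hα
    (scalingVariable_nonneg (α * β) (t, x, y))).const_mul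
      (C₁ * (t : ℝ) ^ (-n / (α * β)))).congr ?_
  filter_upwards [(hS.isStableLaw hβ).pos] with s hs
  exact (kernel_scaled hα hβ hp ht x y hs).symm

/-- The subordinated kernel depends on `(t, x, y)` through the scaling variable, up to a power
of `t`; hence the asymptotics are uniform. -/
lemma subordinatedKernel_eq (hα : 0 < α)
    (hp : ∀ t, 0 < t → ∀ x y : M,
      p t x y = C₁ / t ^ (n / α) * F (C₂ * (dist x y / t ^ (1 / α))))
    (hβ : 0 < β) (hS : IsStableSubordinator P β S) {t : ℝ≥0} (ht : 0 < t) (x y : M) :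
    subordinatedKernel P S p t x y = C₁ * (t : ℝ) ^ (-n / (α * β))
      * stableProfile (P.map (S 1)) F C₂ (n / α) α (scalingVariable (α * β) (t, x, y)) := by
  have ht' : (0 : ℝ) < (t : ℝ) ^ (1 / β) := rpow_pos_of_pos (by exact_mod_cast ht) _
  rw [subordinatedKernel, restrict_Ioi_map hβ hS ht, hS.map_eq hβ ht,
    (measurableEmbedding_mulLeft₀ ht'.ne').integral_map, stableProfile, ← integral_const_mul]
  refine integral_congr_ae ?_
  filter_upwards [(hS.isStableLaw hβ).pos] with s hs
  exact kernel_scaled hα hβ hp ht x y hs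

end Kernel

/-! ### Asymptotics -/

lemma integrableOn_Ioi_zero_rpow_mul {F : ℝ → ℝ} (hF_pos : ∀ r, 0 ≤ r → 0 < F r)
    (hF_anti : AntitoneOn F (Ici 0)) {N : ℝ} (hN : 0 < N)
    (h : IntegrableOn (fun s : ℝ => s ^ (N - 1) * F s) (Ioi 1)) :
    IntegrableOn (fun s : ℝ => s ^ (N - 1) * F s) (Ioi 0) := by
  rw [← Ioc_union_Ioi_eq_Ioi zero_le_one]
  refine IntegrableOn.union ?_ h
  have h1 : IntegrableOn (fun s : ℝ => s ^ (N - 1)) (Ioc 0 1) :=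
    (intervalIntegrable_iff_integrableOn_Ioc_of_le zero_le_one).1
      (intervalIntegral.intervalIntegrable_rpow' (by linarith))
  refine Integrable.mul_bdd (c := F 0) h1 (aemeasurable_restrict_of_antitoneOn measurableSet_Ioc
    (hF_anti.mono fun s hs => hs.1.le)).aestronglyMeasurable ?_
  filter_upwards [ae_restrict_mem measurableSet_Ioc] with s hs
  rw [norm_of_nonneg (hF_pos s hs.1.le).le]
  exact hF_anti self_mem_Ici hs.1.le hs.1.le

lemma setIntegral_Ioi_rpow_mul_pos {F : ℝ → ℝ} (hF_pos : ∀ r, 0 ≤ r → 0 < F r) {a : ℝ}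
    (h : IntegrableOn (fun s : ℝ => s ^ a * F s) (Ioi 0)) :
    0 < ∫ s in Ioi (0 : ℝ), s ^ a * F s := by
  have hpos : ∀ s ∈ Ioi (0 : ℝ), 0 < s ^ a * F s := fun s (hs : 0 < s) =>
    mul_pos (rpow_pos_of_pos hs _) (hF_pos s hs.le)
  have hsub : Ioi (0 : ℝ) ⊆ Function.support fun s : ℝ => s ^ a * F s := fun s hs =>
    (hpos s hs).ne'
  rw [setIntegral_pos_iff_support_of_nonneg_ae
    ((ae_restrict_mem measurableSet_Ioi).mono fun s hs => (hpos s hs).le) h,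
    inter_eq_right.2 hsub]
  simp

lemma tendsto_rightLim_zero {F : ℝ → ℝ} (hF_anti : AntitoneOn F (Ici 0)) :
    Tendsto F (𝓝[>] 0) (𝓝 (Function.rightLim F 0)) := by
  have h : Tendsto F (𝓝[>] 0) (𝓝 (sSup (F '' Ioi 0))) :=
    (hF_anti.mono Ioi_subset_Ici_self).tendsto_nhdsGT
      ⟨F 0, by
        rintro _ ⟨s, hs, rfl⟩
        exact hF_anti self_mem_Ici (Ioi_subset_Ici_self hs) (le_of_lt hs)⟩
  rwa [rightLim_eq_of_tendsto h]

lemma rightLim_zero_pos {F : ℝ → ℝ} (hF_pos : ∀ r, 0 ≤ r → 0 < F r)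
    (hF_anti : AntitoneOn F (Ici 0)) : 0 < Function.rightLim F 0 := by
  refine (hF_pos 1 zero_le_one).trans_le (ge_of_tendsto (tendsto_rightLim_zero hF_anti) ?_)
  filter_upwards [Ioo_mem_nhdsGT zero_lt_one] with s hs
  exact hF_anti hs.1.le (mem_Ici.2 zero_le_one) hs.2.le

theorem mainTheorem2 {M : Type*} [MetricSpace M]
    {Ω : Type*} [MeasurableSpace Ω] (P : Measure Ω) [IsProbabilityMeasure P]
    (n α C₁ C₂ : ℝ) (hn : 0 < n) (hα : 0 < α) (hC₁ : 0 < C₁) (hC₂ : 0 < C₂)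
    (F : ℝ → ℝ) (hF_pos : ∀ r, 0 ≤ r → 0 < F r) (hF_anti : AntitoneOn F (Ici 0))
    (p : ℝ → M → M → ℝ)
    (hp : ∀ t, 0 < t → ∀ x y : M,
      p t x y = C₁ / t ^ (n / α) * F (C₂ * (dist x y / t ^ (1 / α))))
    (β : ℝ) (hβ₀ : 0 < β) (hβ₁ : β < 1)
    (S : ℝ≥0 → Ω → ℝ) (hS : IsStableSubordinator P β S) :
    -- the integral defining the subordinated kernel converges
    (∀ t : ℝ≥0, 0 < t → ∀ x y : M,
      IntegrableOn (fun s => p s x y) (Ioi 0) (P.map (S t))) ∧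
    -- (a)
    (IntegrableOn (fun s : ℝ => s ^ (n + α * β - 1) * F s) (Ioi 1) →
      IntegrableOn (fun s : ℝ => s ^ (n + α * β - 1) * F s) (Ioi 0) ∧
      (fun q : ℝ≥0 × M × M => subordinatedKernel P S p q.1 q.2.1 q.2.2)
        ~[scalingRegime M (α * β) atTop]
      (fun q : ℝ≥0 × M × M =>
        C₁ * (α * β / Gamma (1 - β)) * C₂ ^ (-n - α * β)
          * (∫ s in Ioi (0 : ℝ), s ^ (n + α * β - 1) * F s)
          * dist q.2.1 q.2.2 ^ (-n - α * β) * (q.1 : ℝ))) ∧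
    -- (b), off the diagonal
    ((fun q : ℝ≥0 × M × M => subordinatedKernel P S p q.1 q.2.1 q.2.2)
        ~[scalingRegime M (α * β) (𝓝[>] 0)]
      (fun q : ℝ≥0 × M × M =>
        C₁ * Function.rightLim F 0 * (Gamma (n / (α * β)) / (β * Gamma (n / α)))
          * (q.1 : ℝ) ^ (-n / (α * β)))) ∧
    -- (b), including the diagonal, when `F 0 = F (0+)`
    (F 0 = Function.rightLim F 0 →
      (fun q : ℝ≥0 × M × M => subordinatedKernel P S p q.1 q.2.1 q.2.2)
        ~[scalingRegime M (α * β) (𝓝 0)]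
      (fun q : ℝ≥0 × M × M =>
        C₁ * Function.rightLim F 0 * (Gamma (n / (α * β)) / (β * Gamma (n / α)))
          * (q.1 : ℝ) ^ (-n / (α * β)))) := by
  have hμ := hS.isStableLaw hβ₀
  have hG : 0 < Gamma (1 - β) := Gamma_pos_of_pos (by linarith)
  have hpos : ∀ l : Filter ℝ, ∀ᶠ q in scalingRegime M (α * β) l, 0 < q.1 := fun l =>
    mem_inf_of_right (mem_principal_self _)
  have hsv : ∀ l : Filter ℝ,
      Tendsto (scalingVariable (α * β)) (scalingRegime M (α * β) l) l := fun l =>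
    tendsto_comap.mono_left inf_le_left
  -- Both cases of small scaling variable; `K` is the set of values that it may take.
  have hsmall : ∀ l : Filter ℝ, ∀ K ⊆ Ici (0 : ℝ), (∀ c, 0 < c → ∀ z ∈ K, c * z ∈ K) →
      Tendsto F (𝓝[K] 0) (𝓝 (Function.rightLim F 0)) →
      Tendsto (scalingVariable (α * β)) (scalingRegime M (α * β) l) (𝓝[K] 0) →
      (fun q : ℝ≥0 × M × M => subordinatedKernel P S p q.1 q.2.1 q.2.2)
        ~[scalingRegime M (α * β) l]
      (fun q : ℝ≥0 × M × M =>
        C₁ * Function.rightLim F 0 * (Gamma (n / (α * β)) / (β * Gamma (n / α)))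
          * (q.1 : ℝ) ^ (-n / (α * β))) := by
    intro l K hK₀ hK hA hz
    have h := (hμ.tendsto_profile_zero hβ₀ (div_pos hn hα) hF_pos hF_anti hC₂ hα hK₀ hK hA).comp hz
    rw [div_div n α β] at h
    have hne : Function.rightLim F 0 * (Gamma (n / (α * β)) / (β * Gamma (n / α))) ≠ 0 := by
      have := rightLim_zero_pos hF_pos hF_anti
      have := Gamma_pos_of_pos (div_pos hn hα)
      have := Gamma_pos_of_pos (div_pos hn (mul_pos hα hβ₀))
      positivity
    have h2 := (IsEquivalent.refl (u := fun q : ℝ≥0 × M × M =>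
      C₁ * (q.1 : ℝ) ^ (-n / (α * β)))).mul ((isEquivalent_const_iff_tendsto hne).2 h)
    refine (h2.congr_left ?_).congr_right (.of_forall fun q => ?_)
    · filter_upwards [hpos l] with q hq
      exact (subordinatedKernel_eq hα hp hβ₀ hS hq q.2.1 q.2.2).symm
    · simp only [Pi.mul_apply, Function.const_apply]
      ring
  refine ⟨fun t ht x y => integrableOn_kernel hn hα hC₂ hF_pos hF_anti hp hβ₀ hS ht x y,
    fun hint => ?_, ?_, fun hF0 => ?_⟩
  · have hint₀ := integrableOn_Ioi_zero_rpow_mul hF_pos hF_anti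
      (show 0 < n + α * β by positivity) hint
    refine ⟨hint₀, ?_⟩
    have h := (hμ.tendsto_rpow_mul_profile hβ₀ hβ₁ hF_pos hF_anti hn hC₂ hα hint₀).comp
      (hsv atTop)
    have hI := setIntegral_Ioi_rpow_mul_pos hF_pos hint₀
    set I := ∫ s in Ioi (0 : ℝ), s ^ (n + α * β - 1) * F s
    have hne : α * β / Gamma (1 - β) * C₂ ^ (-n - α * β) * I ≠ 0 := by positivity
    have h2 := (IsEquivalent.refl (u := fun q : ℝ≥0 × M × M =>
      C₁ * (q.1 : ℝ) ^ (-n / (α * β)) * scalingVariable (α * β) q ^ (-(n + α * β)))).mul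
      ((isEquivalent_const_iff_tendsto hne).2 h)
    have hz : ∀ᶠ q in scalingRegime M (α * β) atTop, 0 < scalingVariable (α * β) q :=
      (hsv atTop).eventually (eventually_gt_atTop 0)
    refine (h2.congr_left ?_).congr_right ?_
    · filter_upwards [hpos atTop, hz] with q hq hqz
      rw [subordinatedKernel_eq hα hp hβ₀ hS hq q.2.1 q.2.2]
      simp only [Pi.mul_apply, Function.comp, Prod.mk.eta]
      rw [rpow_neg hqz.le]
      have := rpow_pos_of_pos hqz (n + α * β)
      field_simp
    · filter_upwards [hpos atTop] with q hq
      have hq' : (0 : ℝ) < q.1 := by exact_mod_cast hq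
      have hpow : (q.1 : ℝ) ^ (-n / (α * β)) * ((q.1 : ℝ) ^ (-1 / (α * β))) ^ (-(n + α * β))
          = q.1 := by
        rw [← rpow_mul hq'.le, ← rpow_add hq']
        convert rpow_one (q.1 : ℝ) using 2
        field_simp
        ring
      simp only [Pi.mul_apply, Function.const_apply, scalingVariable]
      rw [mul_rpow dist_nonneg (by positivity), show -n - α * β = -(n + α * β) by ring]
      linear_combination (C₁ * (dist q.2.1 q.2.2) ^ (-(n + α * β))
        * (α * β / Gamma (1 - β) * C₂ ^ (-(n + α * β)) * I)) * hpow
  · exact hsmall _ (Ioi 0) Ioi_subset_Ici_self (fun c hc z hz => mul_pos hc hz)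
      (tendsto_rightLim_zero hF_anti) (hsv _)
  · refine hsmall _ (Ici 0) subset_rfl (fun c hc z hz => mul_nonneg hc.le hz) ?_
      (tendsto_nhdsWithin_iff.2 ⟨hsv _, .of_forall fun q => scalingVariable_nonneg _ q⟩)
    rw [← Ioi_insert, nhdsWithin_insert, tendsto_sup]
    exact ⟨by rw [← hF0]; exact tendsto_pure_nhds F 0, tendsto_rightLim_zero hF_anti⟩
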